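/- Let $n,N\in\mathbb N$, let $M=\mathbb R^{2n}/\mathbb Z^{2n}$ with periodic coordinates $(x,y)=(x^1,\dots,x^n,y^1,\dots,y^n)$ and symplectic form $\omega=2\pi\sum_i dx^i\wedge dy^i$, and let $P=\langle\partial_{y^1},\dots,\partial_{y^n}\rangle$, $Q=\langle\partial_{x^1},\dots,\partial_{x^n}\rangle$. Let $L\to M$ be the prequantum line bundle obtained from $(\mathbb R^{2n}\times\mathbb C,\ d-2\pi\sqrt{-1}\sum_i x^i\,dy^i)$ by the action $(\mu,\nu)\cdot(x,y,c)=(x+\mu,y+\nu,e^{2\pi\sqrt{-1}\langle\mu,y\rangle}c)$ of $\mathbb Z^{2n}$. For $k\in\mathbb Z^+$, test sections $\tau\in\Gamma(M,(L^*)^{\otimes k})$ are identified with smooth functions on $\mathbb R^{2n}$ satisfying $\tau(x+\mu,y+\nu)=e^{-2\pi k\sqrt{-1}\langle\mu,y\rangle}\tau(x,y)$ for $\mu,\nu\in\mathbb Z^n$. The space $\Gamma^{-\infty}(M,L^{\otimes k})$ of distributional sections is the continuous dual of $\Gamma(M,(L^*)^{\otimes k})$ for its $C^\infty$ topology; covariant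 derivatives act on it weakly, $\langle\nabla_X s,\tau\rangle=-\langle s,\nabla_X\tau\rangle$ for $X=\partial_{x^i},\partial_{y^j}$, functions act by $\langle gs,\tau\rangle=\langle s,g\tau\rangle$, and $\Gamma_P^{-\infty}(M,L^{\otimes k})$ is the subspace of those $s$ with $\nabla_{\partial_{y^j}}s=0$ for all $j$. For $m\in\mathbb Z^n$ let $\widetilde\tau_m(x)=\int_{[0,1]^n}e^{2\pi\sqrt{-1}\langle m,y\rangle}\tau(x,y)\,d^ny$ be the Weil–Brezin coefficients of $\tau$, and for $f\in C^\infty(M)$ and $p\in\mathbb Z^n$ let $\widehat f_p(x)=\int_{[0,1]^n}e^{-2\pi\sqrt{-1}\langle p,y\rangle}f(x,y)\,d^ny$. The space $\Gamma_P^{-\infty}(M,L^{\otimes k})$ has the basis $\sigma_k^{[m]}$, $[m]\in(\mathbb Z/k\mathbb Z)^n$, where $\langle\sigma_k^{[m]},\tau\rangle=\widetilde\tau_m(m/k)$. For $s=\sum_{[m]}s_{[m]}\sigma_k^{[m]}$ put $\|s\|_{\ell^1}=\sum_{[m]}|s_{[m]}|$, and put $$\|\tau\|_N=\sup\Big\{\Big|\tfrac{\partial^r\widetilde\tau_m}{\partial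 x^{i_1}\cdots\partial x^{i_r}}(x)\Big| : [m]\in(\mathbb Z/k\mathbb Z)^n,\ r\le N,\ 1\le i_1,\dots,i_r\le n,\ x\in\mathbb R^n\Big\}.$$ For $f\in C^\infty(M)$ let $T_{f,k}$ be the Toeplitz-type operator on $\Gamma_P^{-\infty}(M,L^{\otimes k})$, i.e. the linear operator with $$\langle T_{f,k}\sigma_k^{[m]},\tau\rangle=\sum_{p\in\mathbb Z^n}\big(\widehat f_p\cdot\widetilde\tau_{m+p}\big)\Big(\frac{m+p}{k}\Big),$$ and for $r\in\mathbb N$ let $T_{f,r,k}=(\mathbf J_f)_r\circledast_k$ be the operator on $\Gamma^{-\infty}(M,L^{\otimes k})$ given by the component of polarized weight $r$ of the quantum jet $\mathbf J_f$ of $f$. Here $\mathbf J_f$ is the section of $\widehat{\operatorname{Sym}}\,T^*M_{\mathbb C}[[\hbar]]$ that is flat for $D=d-\delta$ and has component $f$ in $C^\infty(M)[[\hbar]]$ (with $\delta=\sum_i dx^i\,\partial_{u^i}+\sum_j dy^j\,\partial_{\check u^j}$, where $u^i,\check u^j$ are the generators corresponding to $dx^i,dy^j$); $\check u^j$ and $\hbar$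 have weight $1$ and $u^i$ has weight $0$; and $\circledast_k$ lets the part free of the $u^i$ act with $\hbar=\frac{\sqrt{-1}}k$ and $\check u^j\mapsto\frac{\sqrt{-1}}{2\pi k}\nabla_{\partial_{x^j}}$. Explicitly, $$T_{f,r,k}=\frac1{r!}\Big(\frac{\sqrt{-1}}{2\pi k}\Big)^r\sum_{1\le j_1,\dots,j_r\le n}\frac{\partial^rf}{\partial y^{j_1}\cdots\partial y^{j_r}}\,\nabla_{\partial_{x^{j_1}}}\cdots\nabla_{\partial_{x^{j_r}}}.$$ **Theorem.** For every $f\in C^\infty(M)$ and $N\in\mathbb N$ there is a constant $C_{f,N}>0$ such that for all $k\in\mathbb Z^+$, all $s\in\Gamma_P^{-\infty}(M,L^{\otimes k})$ and all test sections $\tau\in\Gamma(M,(L^*)^{\otimes k})$, $$\Big|\Big\langle T_{f,k}s-\sum_{r=0}^NT_{f,r,k}s,\ \tau\Big\rangle\Big|\le C_{f,N}\,\|s\|_{\ell^1}\,\|\tau\|_{N+1}\,\frac1{k^{N+1}}.$$ -/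

import Mathlib

open scoped ContDiff

noncomputable section

namespace SymplecticTorus

/-- The universal cover `ℝ²ⁿ` of the torus `M = ℝ²ⁿ/ℤ²ⁿ`, with coordinates `(x, y)`; the symplectic
form is `ω = 2π ∑ dxⁱ ∧ dyⁱ`. -/
abbrev Phase (n : ℕ) : Type := (Fin n → ℝ) × (Fin n → ℝ)

/-- A vector of integers, regarded as a vector of reals. -/
def intVec {n : ℕ} (μ : Fin n → ℤ) : Fin n → ℝ := fun i => (μ i : ℝ)

/-- The unit cube `[0,1]ⁿ`. -/
def cube (n : ℕ) : Set (Fin n → ℝ) := Set.Icc 0 1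

/-- The character `e^{2πi⟨m, y⟩}`. -/
def character {n : ℕ} (m : Fin n → ℤ) (y : Fin n → ℝ) : ℂ :=
  Complex.exp (2 * Real.pi * Complex.I * ∑ i, (m i : ℂ) * (y i : ℂ))

/-- Smooth sections of `L^{⊗d}` over the torus, for `d ∈ ℤ` (negative powers are powers of the dual
`L^*`), as smooth functions on `ℝ²ⁿ` that are equivariant for the factor of automorphy
`e^{2πi d⟨μ, y⟩}` of `(μ, ν) ∈ ℤ²ⁿ`. For `d = 0` these are the smooth functions on the torus. -/
def lineSection (n : ℕ) (d : ℤ) : Submodule ℂ (Phase n → ℂ) where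
  carrier := {τ | ContDiff ℝ ∞ τ ∧ ∀ (μ ν : Fin n → ℤ) (x y : Fin n → ℝ),
    τ (x + intVec μ, y + intVec ν) = character (d • μ) y * τ (x, y)}
  zero_mem' := ⟨contDiff_const, by simp⟩
  add_mem' := by
    rintro σ τ ⟨h1, h2⟩ ⟨h3, h4⟩
    refine ⟨h1.add h3, fun μ ν x y => ?_⟩
    simp only [Pi.add_apply, h2, h4, mul_add]
  smul_mem' := by
    rintro c τ ⟨h1, h2⟩
    refine ⟨contDiff_const.smul h1, fun μ ν x y => ?_⟩
    simp only [Pi.smul_apply, h2, smul_eq_mul]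
    ring

/-- Complex valued smooth functions on the torus. -/
abbrev TorusFunction (n : ℕ) : Type := lineSection n 0

variable {n : ℕ} {d : ℤ}

theorem contDiff_section (τ : lineSection n d) : ContDiff ℝ ∞ (τ : Phase n → ℂ) := τ.2.1

theorem section_translate (τ : lineSection n d) (μ ν : Fin n → ℤ) (z : Phase n) :
    (τ : Phase n → ℂ) (z + (intVec μ, intVec ν)) = character (d • μ) z.2 * (τ : Phase n → ℂ) z :=
  τ.2.2 μ ν z.1 z.2

theorem hasFDerivAt_character (m : Fin n → ℤ) (y : Fin n → ℝ) :
    ∃ D : (Fin n → ℝ) →L[ℝ] ℂ, HasFDerivAt (character m) D y ∧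
      ∀ v, D v = 2 * Real.pi * Complex.I * (∑ i, (m i : ℂ) * (v i : ℂ)) * character m y := by
  have h1 : ∀ i : Fin n, HasFDerivAt (fun y : Fin n → ℝ => (m i : ℂ) * (y i : ℂ))
      ((m i : ℂ) • (Complex.ofRealCLM.comp (ContinuousLinearMap.proj i))) y := by
    intro i
    exact (Complex.ofRealCLM.comp (ContinuousLinearMap.proj (R := ℝ) (φ := fun _ : Fin n => ℝ)
      i)).hasFDerivAt.const_mul (m i : ℂ)
  have h2 := ((HasFDerivAt.fun_sum fun i (_ : i ∈ Finset.univ) => h1 i).const_mul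
    (2 * Real.pi * Complex.I)).cexp
  refine ⟨_, h2, fun v => ?_⟩
  simp [character]
  ring

theorem contDiff_character (m : Fin n → ℤ) : ContDiff ℝ ∞ (character m) := by
  unfold character
  refine ContDiff.cexp (contDiff_const.mul (ContDiff.sum fun i _ => contDiff_const.mul ?_))
  exact Complex.ofRealCLM.contDiff.comp (contDiff_apply ℝ ℝ i)

theorem norm_character (m : Fin n → ℤ) (y : Fin n → ℝ) : ‖character m y‖ = 1 := by
  have : character m y = Complex.exp (((2 * Real.pi * ∑ i, (m i : ℝ) * y i : ℝ) : ℂ) * Complex.I) := by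
    unfold character
    congr 1
    push_cast
    ring
  rw [this, Complex.norm_exp_ofReal_mul_I]

theorem fderiv_translate (τ : lineSection n d) (μ ν : Fin n → ℤ) (z v : Phase n) :
    fderiv ℝ (τ : Phase n → ℂ) (z + (intVec μ, intVec ν)) v =
      character (d • μ) z.2 * fderiv ℝ (τ : Phase n → ℂ) z v +
      2 * Real.pi * Complex.I * (∑ i, ((d • μ) i : ℂ) * (v.2 i : ℂ)) * character (d • μ) z.2 *
        (τ : Phase n → ℂ) z := by
  have hd : Differentiable ℝ (τ : Phase n → ℂ) := (contDiff_section τ).differentiable (by simp)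
  obtain ⟨D, hD, hv⟩ := hasFDerivAt_character (d • μ) z.2
  have h1 : HasFDerivAt (fun z : Phase n => (τ : Phase n → ℂ) (z + (intVec μ, intVec ν)))
      (fderiv ℝ (τ : Phase n → ℂ) (z + (intVec μ, intVec ν))) z :=
    hasFDerivAt_comp_add_right _ |>.2 (hd _).hasFDerivAt
  have h2 := (hD.comp z (hasFDerivAt_snd (𝕜 := ℝ) (p := z))).mul (hd z).hasFDerivAt
  have h3 : (fun z : Phase n => (τ : Phase n → ℂ) (z + (intVec μ, intVec ν))) =
      (character (d • μ) ∘ Prod.snd) * (τ : Phase n → ℂ) := by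
    funext z
    exact section_translate τ μ ν z
  rw [h3] at h1
  rw [h1.unique h2]
  simp [hv]
  ring

/-- The covariant derivative `∇_{∂/∂xⁱ}` on `L^{⊗d}`, for the connection `d - 2πi d ∑ xⁱ dyⁱ`. -/
def covX (i : Fin n) : lineSection n d →ₗ[ℂ] lineSection n d where
  toFun τ := ⟨fun z => fderiv ℝ (τ : Phase n → ℂ) z (Pi.single i 1, 0), by
    refine ⟨((contDiff_section τ).fderiv_right (m := ∞) (by simp)).clm_apply contDiff_const, ?_⟩
    intro μ ν x y
    have := fderiv_translate τ μ ν (x, y) (Pi.single i 1, 0)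
    simpa using this⟩
  map_add' σ τ := by
    ext z
    have h1 : Differentiable ℝ (σ : Phase n → ℂ) := (contDiff_section σ).differentiable (by simp)
    have h2 : Differentiable ℝ (τ : Phase n → ℂ) := (contDiff_section τ).differentiable (by simp)
    simp [fderiv_add (h1 z) (h2 z)]
  map_smul' c τ := by
    ext z
    have h2 : Differentiable ℝ (τ : Phase n → ℂ) := (contDiff_section τ).differentiable (by simp)
    simp [fderiv_const_smul (h2 z) c]

/-- The covariant derivative `∇_{∂/∂yʲ}` on `L^{⊗d}`, for the connection `d - 2πi d ∑ xⁱ dyⁱ`. For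
`d = 0` it is the partial derivative `∂/∂yʲ`. -/
def covY (j : Fin n) : lineSection n d →ₗ[ℂ] lineSection n d where
  toFun τ := ⟨fun z => fderiv ℝ (τ : Phase n → ℂ) z (0, Pi.single j 1) -
      2 * Real.pi * Complex.I * d * z.1 j * (τ : Phase n → ℂ) z, by
    refine ⟨(((contDiff_section τ).fderiv_right (m := ∞) (by simp)).clm_apply contDiff_const).sub
      ((contDiff_const.mul (Complex.ofRealCLM.contDiff.comp
        ((contDiff_apply ℝ ℝ j).comp contDiff_fst))).mul (contDiff_section τ)), ?_⟩
    intro μ ν x y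
    have h1 := fderiv_translate τ μ ν (x, y) (0, Pi.single j 1)
    have h2 := section_translate τ μ ν (x, y)
    simp only [Prod.mk_add_mk] at h1 h2
    simp only [h1, h2]
    have h3 : ∑ i, (((d • μ) i : ℤ) : ℂ) * (((Pi.single j 1 : Fin n → ℝ) i : ℝ) : ℂ) =
        (d : ℂ) * μ j := by
      rw [Finset.sum_eq_single j]
      · simp
      · intro b _ hb
        simp [hb]
      · simp
    rw [h3]
    simp [intVec]
    ring⟩
  map_add' σ τ := by
    ext z
    have h1 : Differentiable ℝ (σ : Phase n → ℂ) := (contDiff_section σ).differentiable (by simp)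
    have h2 : Differentiable ℝ (τ : Phase n → ℂ) := (contDiff_section τ).differentiable (by simp)
    simp [fderiv_add (h1 z) (h2 z)]
    ring
  map_smul' c τ := by
    ext z
    have h2 : Differentiable ℝ (τ : Phase n → ℂ) := (contDiff_section τ).differentiable (by simp)
    simp [fderiv_const_smul (h2 z) c]
    ring

/-- Multiplication of sections of `L^{⊗d}` by a smooth function on the torus. -/
def mulFunction (g : TorusFunction n) : lineSection n d →ₗ[ℂ] lineSection n d where
  toFun τ := ⟨fun z => (g : Phase n → ℂ) z * (τ : Phase n → ℂ) z, by
    refine ⟨(contDiff_section g).mul (contDiff_section τ), fun μ ν x y => ?_⟩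
    have h1 := section_translate g μ ν (x, y)
    have h2 := section_translate τ μ ν (x, y)
    simp only [Prod.mk_add_mk] at h1 h2
    simp only [h1, h2]
    simp [character]
    ring⟩
  map_add' σ τ := by
    ext z
    simp [mul_add]
  map_smul' c τ := by
    ext z
    simp
    ring

/-! ### Distributional sections -/

/-- The derivatives of `τ` up to order `N` are bounded by `B` on `S`. -/
def BoundedOn (S : Set (Phase n)) (N : ℕ) (B : ℝ) (τ : lineSection n d) : Prop :=
  ∀ j ≤ N, ∀ z ∈ S, ‖iteratedFDeriv ℝ j (τ : Phase n → ℂ) z‖ ≤ B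

theorem BoundedOn.mono {S S' : Set (Phase n)} {N N' : ℕ} {B : ℝ} {τ : lineSection n d}
    (h : BoundedOn S' N' B τ) (hS : S ⊆ S') (hN : N ≤ N') : BoundedOn S N B τ :=
  fun j hj z hz => h j (hj.trans hN) z (hS hz)

/-- Distributional sections of `L^{⊗d}`: the continuous linear functionals on the space of (test)
sections of `(L^*)^{⊗d}`, for the smooth topology (uniform convergence on compact sets of all
derivatives). A functional is continuous when finitely many of the seminorms of that topology
control it. -/
def distSection (n : ℕ) (d : ℤ) : Submodule ℂ (Module.Dual ℂ (lineSection n (-d))) where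
  carrier := {s | ∃ (S : Set (Phase n)) (N : ℕ) (C : ℝ), IsCompact S ∧
    ∀ (τ : lineSection n (-d)) (B : ℝ), 0 ≤ B → BoundedOn S N B τ → ‖s τ‖ ≤ C * B}
  zero_mem' := ⟨∅, 0, 0, isCompact_empty, by simp⟩
  add_mem' := by
    rintro s t ⟨S, N, C, hS, h⟩ ⟨S', N', C', hS', h'⟩
    refine ⟨S ∪ S', max N N', C + C', hS.union hS', fun τ B hB hτ => ?_⟩
    have h1 := h τ B hB (hτ.mono Set.subset_union_left (le_max_left _ _))
    have h2 := h' τ B hB (hτ.mono Set.subset_union_right (le_max_right _ _))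
    calc ‖(s + t) τ‖ ≤ ‖s τ‖ + ‖t τ‖ := norm_add_le _ _
      _ ≤ (C + C') * B := by linarith
  smul_mem' := by
    rintro c s ⟨S, N, C, hS, h⟩
    refine ⟨S, N, ‖c‖ * C, hS, fun τ B hB hτ => ?_⟩
    have h1 := h τ B hB hτ
    calc ‖(c • s) τ‖ = ‖c‖ * ‖s τ‖ := by simp
      _ ≤ ‖c‖ * (C * B) := by gcongr
      _ = ‖c‖ * C * B := by ring

/-- Continuity of a linear operator on sections, in terms of the seminorms. -/
def ContinuousOperator (A : lineSection n d →ₗ[ℂ] lineSection n d) : Prop :=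
  ∀ (S : Set (Phase n)) (N : ℕ), IsCompact S → ∃ (N' : ℕ) (C : ℝ), 0 ≤ C ∧
    ∀ (τ : lineSection n d) (B : ℝ), 0 ≤ B → BoundedOn S N' B τ → BoundedOn S N (C * B) (A τ)

/-- The transpose `⟨Aᵗ s, τ⟩ = ⟨s, A τ⟩` of a continuous operator on test sections. -/
def transposeOperator (A : lineSection n (-d) →ₗ[ℂ] lineSection n (-d))
    (hA : ContinuousOperator A) : distSection n d →ₗ[ℂ] distSection n d where
  toFun s := ⟨s.1 ∘ₗ A, by
    obtain ⟨S, N, C, hS, h⟩ := s.2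
    obtain ⟨N', C', hC', h'⟩ := hA S N hS
    refine ⟨S, N', C * C', hS, fun τ B hB hτ => ?_⟩
    have := h (A τ) (C' * B) (by positivity) (h' τ B hB hτ)
    simpa [mul_assoc] using this⟩
  map_add' s t := rfl
  map_smul' c s := rfl

theorem iteratedFDeriv_fderiv_bound {τ : Phase n → ℂ} (hτ : ContDiff ℝ ∞ τ) (j : ℕ)
    (z v : Phase n) :
    ‖iteratedFDeriv ℝ j (fun z => fderiv ℝ τ z v) z‖ ≤ ‖v‖ * ‖iteratedFDeriv ℝ (j + 1) τ z‖ := by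
  have h : ContDiff ℝ ∞ (fderiv ℝ τ) := hτ.fderiv_right (by simp)
  have := norm_iteratedFDeriv_clm_apply_const (𝕜 := ℝ) (f := fderiv ℝ τ) (c := v) (x := z)
    (N := ∞) (n := j) h.contDiffAt (by exact_mod_cast le_top)
  rwa [norm_iteratedFDeriv_fderiv] at this

theorem iteratedFDeriv_mul_bound {h : Phase n → ℂ} (hh : ContDiff ℝ ∞ h) {S : Set (Phase n)}
    (hS : IsCompact S) (N : ℕ) : ∃ C : ℝ, 0 ≤ C ∧ ∀ (τ : Phase n → ℂ) (B : ℝ), ContDiff ℝ ∞ τ →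
      0 ≤ B → (∀ j ≤ N, ∀ z ∈ S, ‖iteratedFDeriv ℝ j τ z‖ ≤ B) →
      ∀ j ≤ N, ∀ z ∈ S, ‖iteratedFDeriv ℝ j (fun z => h z * τ z) z‖ ≤ C * B := by
  have h1 : ∀ i : ℕ, ∃ C : ℝ, 0 ≤ C ∧ ∀ z ∈ S, ‖iteratedFDeriv ℝ i h z‖ ≤ C := by
    intro i
    have hc : Continuous (iteratedFDeriv ℝ i h) :=
      hh.continuous_iteratedFDeriv (by exact_mod_cast le_top)
    obtain ⟨C, hC⟩ := hS.exists_bound_of_continuousOn hc.continuousOn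
    exact ⟨max C 0, le_max_right _ _, fun z hz => (hC z hz).trans (le_max_left _ _)⟩
  choose C hC0 hC using h1
  refine ⟨∑ j ∈ Finset.range (N + 1), ∑ i ∈ Finset.range (j + 1), (j.choose i : ℝ) * C i,
    Finset.sum_nonneg fun j _ => Finset.sum_nonneg fun i _ => mul_nonneg (by positivity) (hC0 i),
    fun τ B hτ hB hb j hj z hz => ?_⟩
  have h2 := norm_iteratedFDeriv_mul_le hh hτ z (n := j) (by exact_mod_cast le_top)
  calc ‖iteratedFDeriv ℝ j (fun z => h z * τ z) z‖
      ≤ ∑ i ∈ Finset.range (j + 1), (j.choose i : ℝ) * ‖iteratedFDeriv ℝ i h z‖ *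
          ‖iteratedFDeriv ℝ (j - i) τ z‖ := h2
    _ ≤ ∑ i ∈ Finset.range (j + 1), (j.choose i : ℝ) * C i * B := by
        gcongr with i hi
        · exact mul_nonneg (by positivity) (hC0 i)
        · exact hC i z hz
        · exact hb _ (by omega) z hz
    _ = (∑ i ∈ Finset.range (j + 1), (j.choose i : ℝ) * C i) * B := by rw [Finset.sum_mul]
    _ ≤ _ := by
        gcongr
        exact Finset.single_le_sum (f := fun j => ∑ i ∈ Finset.range (j + 1), (j.choose i : ℝ) * C i)
          (fun j _ => Finset.sum_nonneg fun i _ => mul_nonneg (by positivity) (hC0 i))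
          (Finset.mem_range.2 (by omega))

theorem continuousOperator_covX (i : Fin n) :
    ContinuousOperator (covX i : lineSection n d →ₗ[ℂ] lineSection n d) := by
  intro S N _
  refine ⟨N + 1, ‖((Pi.single i 1, 0) : Phase n)‖, norm_nonneg _, fun τ B _ hτ j hj z hz => ?_⟩
  refine (iteratedFDeriv_fderiv_bound (contDiff_section τ) j z _).trans ?_
  gcongr
  exact hτ (j + 1) (by omega) z hz

theorem continuousOperator_mulFunction (g : TorusFunction n) :
    ContinuousOperator (mulFunction g : lineSection n d →ₗ[ℂ] lineSection n d) := by
  intro S N hS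
  obtain ⟨C, hC, h⟩ := iteratedFDeriv_mul_bound (contDiff_section g) hS N
  exact ⟨N, C, hC, fun τ B hB hτ => h τ B (contDiff_section τ) hB hτ⟩

theorem continuousOperator_covY (j : Fin n) :
    ContinuousOperator (covY j : lineSection n d →ₗ[ℂ] lineSection n d) := by
  intro S N hS
  have hh : ContDiff ℝ ∞ (fun z : Phase n => 2 * Real.pi * Complex.I * d * (z.1 j : ℂ)) :=
    contDiff_const.mul (Complex.ofRealCLM.contDiff.comp
        ((contDiff_apply ℝ ℝ j).comp contDiff_fst))
  obtain ⟨C, hC, h⟩ := iteratedFDeriv_mul_bound hh hS N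
  refine ⟨N + 1, ‖((0, Pi.single j 1) : Phase n)‖ + C, by positivity,
    fun τ B hB hτ l hl z hz => ?_⟩
  have h1 : ContDiff ℝ ∞ (fun z => fderiv ℝ (τ : Phase n → ℂ) z (0, Pi.single j 1)) :=
    ((contDiff_section τ).fderiv_right (m := ∞) (by simp)).clm_apply contDiff_const
  have h2 := hh.mul (contDiff_section τ)
  have h3 : iteratedFDeriv ℝ l ((covY j τ : lineSection n d) : Phase n → ℂ) z =
      iteratedFDeriv ℝ l (fun z => fderiv ℝ (τ : Phase n → ℂ) z (0, Pi.single j 1)) z -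
      iteratedFDeriv ℝ l (fun z : Phase n => 2 * Real.pi * Complex.I * d * (z.1 j : ℂ) *
        (τ : Phase n → ℂ) z) z :=
    iteratedFDeriv_sub_apply (h1.contDiffAt.of_le (by exact_mod_cast le_top))
      (h2.contDiffAt.of_le (by exact_mod_cast le_top))
  rw [h3, add_mul]
  refine (norm_sub_le _ _).trans (add_le_add ?_ ?_)
  · refine (iteratedFDeriv_fderiv_bound (contDiff_section τ) l z _).trans ?_
    gcongr
    exact hτ (l + 1) (by omega) z hz
  · exact h τ B (contDiff_section τ) hB (fun i hi => hτ i (by omega)) l hl z hz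

/-- `∇_{∂/∂xⁱ}` on distributional sections, in the weak sense:
`⟨∇ s, τ⟩ = -⟨s, ∇ τ⟩` (the vector field is divergence free). -/
def distCovX (i : Fin n) : distSection n d →ₗ[ℂ] distSection n d :=
  -transposeOperator (covX i) (continuousOperator_covX i)

/-- `∇_{∂/∂yʲ}` on distributional sections, in the weak sense. -/
def distCovY (j : Fin n) : distSection n d →ₗ[ℂ] distSection n d :=
  -transposeOperator (covY j) (continuousOperator_covY j)

/-- Multiplication of a distributional section by a smooth function: `⟨g s, τ⟩ = ⟨s, g τ⟩`. -/
def distMul (g : TorusFunction n) : distSection n d →ₗ[ℂ] distSection n d :=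
  transposeOperator (mulFunction g) (continuousOperator_mulFunction g)

/-- The `P`-polarized distributional sections of `L^{⊗d}`, where the polarization `P` is spanned by
the `∂/∂yʲ`. -/
def polarizedSection (n : ℕ) (d : ℤ) : Submodule ℂ (distSection n d) :=
  ⨅ j : Fin n, LinearMap.ker (distCovY j)

/-! ### Weil--Brezin coefficients and the basis of polarized sections -/

/-- The `m`-th Weil--Brezin coefficient of `τ`, as a function on `ℝⁿ`:
`τ̃_m(x) = ∫_{[0,1]ⁿ} e^{2πi⟨m, y⟩} τ(x, y) dy`. -/
def weilBrezin (m : Fin n → ℤ) (τ : lineSection n d) (x : Fin n → ℝ) : ℂ :=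
  ∫ y in cube n, character m y * (τ : Phase n → ℂ) (x, y)

/-- The `p`-th fibrewise Fourier coefficient `f̂_p(x) = ∫_{[0,1]ⁿ} e^{-2πi⟨p, y⟩} f(x, y) dy`. -/
def fibreFourier (f : TorusFunction n) (p : Fin n → ℤ) (x : Fin n → ℝ) : ℂ :=
  ∫ y in cube n, character (-p) y * (f : Phase n → ℂ) (x, y)

theorem continuous_integrand (m : Fin n → ℤ) (τ : lineSection n d) (x : Fin n → ℝ) :
    Continuous fun y => character m y * (τ : Phase n → ℂ) (x, y) :=
  (contDiff_character m).continuous.mul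
    ((contDiff_section τ).continuous.comp (by fun_prop))

theorem integrable_integrand (m : Fin n → ℤ) (τ : lineSection n d) (x : Fin n → ℝ) :
    MeasureTheory.IntegrableOn (fun y => character m y * (τ : Phase n → ℂ) (x, y)) (cube n) :=
  (continuous_integrand m τ x).continuousOn.integrableOn_compact isCompact_Icc

theorem weilBrezin_add (m : Fin n → ℤ) (σ τ : lineSection n d) (x : Fin n → ℝ) :
    weilBrezin m (σ + τ) x = weilBrezin m σ x + weilBrezin m τ x := by
  unfold weilBrezin
  rw [← MeasureTheory.integral_add (integrable_integrand m σ x) (integrable_integrand m τ x)]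
  simp [mul_add]

theorem weilBrezin_smul (m : Fin n → ℤ) (c : ℂ) (τ : lineSection n d) (x : Fin n → ℝ) :
    weilBrezin m (c • τ) x = c * weilBrezin m τ x := by
  unfold weilBrezin
  rw [← MeasureTheory.integral_const_mul]
  congr 1
  funext y
  simp
  ring

theorem norm_section_translate (τ : lineSection n d) (x y : Fin n → ℝ) (μ ν : Fin n → ℤ) :
    ‖(τ : Phase n → ℂ) (x + intVec μ, y + intVec ν)‖ = ‖(τ : Phase n → ℂ) (x, y)‖ := by
  have := section_translate τ μ ν (x, y)
  simp only [Prod.mk_add_mk] at this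
  rw [this, norm_mul, norm_character, one_mul]

/-- A bound on the unit cube is a global bound. -/
theorem norm_section_le {τ : lineSection n d} {B : ℝ}
    (h : ∀ z ∈ cube n ×ˢ cube n, ‖(τ : Phase n → ℂ) z‖ ≤ B) (z : Phase n) :
    ‖(τ : Phase n → ℂ) z‖ ≤ B := by
  have hc : ∀ w : Fin n → ℝ, (fun i => Int.fract (w i)) ∈ cube n := fun w =>
    ⟨fun i => Int.fract_nonneg _, fun i => (Int.fract_lt_one _).le⟩
  have hw : ∀ w : Fin n → ℝ, w = (fun i => Int.fract (w i)) + intVec (fun i => ⌊w i⌋) := by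
    intro w
    funext i
    simp [intVec]
  obtain ⟨x, y⟩ := z
  rw [hw x, hw y, norm_section_translate]
  exact h _ ⟨hc x, hc y⟩

theorem norm_weilBrezin_le {τ : lineSection n d} {B : ℝ}
    (h : ∀ z, ‖(τ : Phase n → ℂ) z‖ ≤ B) (m : Fin n → ℤ) (x : Fin n → ℝ) :
    ‖weilBrezin m τ x‖ ≤ B := by
  have hv : MeasureTheory.volume.real (cube n) = 1 := by
    rw [MeasureTheory.Measure.real, cube, Real.volume_Icc_pi]
    simp
  have := MeasureTheory.norm_setIntegral_le_of_norm_le_const (μ := MeasureTheory.volume)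
    (s := cube n) (f := fun y => character m y * (τ : Phase n → ℂ) (x, y)) (C := B)
    (isCompact_Icc.measure_lt_top) (fun y _ => by rw [norm_mul, norm_character, one_mul]; exact h _)
  rwa [hv, mul_one] at this

/-- The integral over the cube of a partial derivative of a periodic function vanishes. -/
theorem integral_partial_eq_zero {g : (Fin n → ℝ) → ℂ} (hg : ContDiff ℝ ∞ g) (j : Fin n)
    (hper : ∀ (ν : Fin n → ℤ) y, g (y + intVec ν) = g y) :
    ∫ y in cube n, fderiv ℝ g y (Pi.single j 1) = 0 := by
  obtain _ | n := n
  · exact j.elim0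
  have hd : Differentiable ℝ g := hg.differentiable (by simp)
  have hcont : Continuous fun y => fderiv ℝ g y (Pi.single j 1) :=
    (hg.continuous_fderiv (by simp)).clm_apply continuous_const
  have key := MeasureTheory.integral_divergence_of_hasFDerivAt_off_countable' (0 : Fin (n + 1) → ℝ)
    1 zero_le_one (fun i => if i = j then g else 0)
    (fun i y => if i = j then fderiv ℝ g y else 0) ∅ Set.countable_empty
    (fun i => by
      by_cases h : i = j
      · simpa [h] using hg.continuous.continuousOn
      · simp only [h, if_false]
        exact continuousOn_const)
    (fun y _ i => by
      by_cases h : i = j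
      · simpa [h] using (hd y).hasFDerivAt
      · simp only [h, if_false]
        exact hasFDerivAt_const (0 : ℂ) y)
    (by
      have : (fun y => ∑ i, (if i = j then fderiv ℝ g y else 0) (Pi.single i (1 : ℝ))) =
          fun y => fderiv ℝ g y (Pi.single j 1) := by
        funext y
        rw [Finset.sum_eq_single j]
        · simp
        · intro b _ hb
          simp [hb]
        · simp
      rw [this]
      exact hcont.continuousOn.integrableOn_compact isCompact_Icc)
  have h1 : (fun y => ∑ i, (if i = j then fderiv ℝ g y else 0) (Pi.single i (1 : ℝ))) =
      fun y => fderiv ℝ g y (Pi.single j 1) := by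
    funext y
    rw [Finset.sum_eq_single j]
    · simp
    · intro b _ hb
      simp [hb]
    · simp
  rw [h1] at key
  rw [cube, key]
  refine Finset.sum_eq_zero fun i _ => ?_
  by_cases h : i = j
  · subst h
    simp only [if_true]
    have h2 : ∀ w : Fin n → ℝ, g (i.insertNth (1 : ℝ) w) = g (i.insertNth (0 : ℝ) w) := by
      intro w
      rw [← hper (Pi.single i 1) (i.insertNth (0 : ℝ) w)]
      congr 1
      funext l
      refine Fin.succAboveCases i ?_ ?_ l
      · simp [intVec]
      · intro l
        simp [intVec]
    simp [h2]
  · simp [h]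

/-- Integration by parts in the fibre variables. -/
theorem weilBrezin_covY (m : Fin n → ℤ) (j : Fin n) (τ : lineSection n d) (x : Fin n → ℝ) :
    weilBrezin m (covY j τ) x =
      -(2 * Real.pi * Complex.I * (m j + d * x j)) * weilBrezin m τ x := by
  have hsm : ContDiff ℝ ∞ fun y => character m y * (τ : Phase n → ℂ) (x, y) :=
    (contDiff_character m).mul ((contDiff_section τ).comp (contDiff_const.prodMk contDiff_id))
  have hper : ∀ (ν : Fin n → ℤ) y, character m (y + intVec ν) * (τ : Phase n → ℂ) (x, y + intVec ν)
      = character m y * (τ : Phase n → ℂ) (x, y) := by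
    intro ν y
    have h1 := section_translate τ 0 ν (x, y)
    have h2 : intVec (0 : Fin n → ℤ) = 0 := by
      funext i
      simp [intVec]
    simp only [Prod.mk_add_mk, h2, add_zero] at h1
    have h3 : character m (y + intVec ν) = character m y := by
      unfold character
      rw [Complex.exp_eq_exp_iff_exists_int]
      refine ⟨∑ i, m i * ν i, ?_⟩
      simp only [Pi.add_apply, intVec, Complex.ofReal_add, mul_add, Finset.sum_add_distrib,
        Int.cast_sum, Int.cast_mul, Complex.ofReal_intCast]
      ring
    rw [h1, h3]
    simp [character]
  have h0 := integral_partial_eq_zero hsm j hper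
  have hfd : ∀ y, fderiv ℝ (fun y => character m y * (τ : Phase n → ℂ) (x, y)) y (Pi.single j 1) =
      character m y * ((covY j τ : lineSection n d) : Phase n → ℂ) (x, y) +
      2 * Real.pi * Complex.I * (m j + d * x j) *
        (character m y * (τ : Phase n → ℂ) (x, y)) := by
    intro y
    obtain ⟨D, hD, hv⟩ := hasFDerivAt_character m y
    have hd : Differentiable ℝ (τ : Phase n → ℂ) := (contDiff_section τ).differentiable (by simp)
    have h1 : HasFDerivAt (fun y => (τ : Phase n → ℂ) (x, y))
        ((fderiv ℝ (τ : Phase n → ℂ) (x, y)).comp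
          ((0 : (Fin n → ℝ) →L[ℝ] (Fin n → ℝ)).prod (ContinuousLinearMap.id ℝ _))) y :=
      (hd (x, y)).hasFDerivAt.comp y ((hasFDerivAt_const x y).prodMk (hasFDerivAt_id y))
    have h2 : HasFDerivAt (fun y => character m y * (τ : Phase n → ℂ) (x, y)) _ y := hD.mul h1
    rw [h2.fderiv]
    have h3 : ∑ i, ((m i : ℤ) : ℂ) * (((Pi.single j 1 : Fin n → ℝ) i : ℝ) : ℂ) = m j := by
      rw [Finset.sum_eq_single j]
      · simp
      · intro b _ hb
        simp [hb]
      · simp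
    simp [hv, h3, covY]
    ring
  simp only [hfd] at h0
  rw [MeasureTheory.integral_add (integrable_integrand m _ x)
    ((integrable_integrand m τ x).const_mul _), MeasureTheory.integral_const_mul] at h0
  unfold weilBrezin
  linear_combination h0

/-- The point `m / k` of `ℝⁿ`. -/
def modePoint (k : ℕ+) (m : Fin n → ℤ) : Fin n → ℝ := fun i => (m i : ℝ) / (k : ℝ)

theorem boundedOn_cube_norm_le {τ : lineSection n d} {B : ℝ}
    (h : BoundedOn (cube n ×ˢ cube n) 0 B τ) (z : Phase n) : ‖(τ : Phase n → ℂ) z‖ ≤ B :=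
  norm_section_le (fun z hz => by simpa using h 0 le_rfl z hz) z

/-- The polarized distributional section `σ_k^{[m]}` of `L^{⊗k}`:
`⟨σ_k^{[m]}, τ⟩ = ∫_{[0,1]ⁿ} e^{2πi⟨m, y⟩} τ(m/k, y) dy = τ̃_m(m/k)`. -/
def sigma (k : ℕ+) (m : Fin n → ℤ) : polarizedSection n (k : ℕ) :=
  ⟨⟨{ toFun := fun τ => weilBrezin m τ (modePoint k m)
      map_add' := fun σ τ => weilBrezin_add m σ τ _
      map_smul' := fun c τ => weilBrezin_smul m c τ _ },
    ⟨cube n ×ˢ cube n, 0, 1, isCompact_Icc.prod isCompact_Icc, fun τ B _ h => by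
      simpa using norm_weilBrezin_le (boundedOn_cube_norm_le h) m (modePoint k m)⟩⟩, by
    simp only [polarizedSection, Submodule.mem_iInf, LinearMap.mem_ker]
    intro j
    apply Subtype.ext
    apply LinearMap.ext
    intro τ
    have hk : ((k : ℕ) : ℂ) ≠ 0 := by exact_mod_cast k.ne_zero
    have h := weilBrezin_covY m j τ (modePoint k m)
    have h0 : ((m j : ℂ) + ((-((k : ℕ) : ℤ) : ℤ) : ℂ) * ((modePoint k m j : ℝ) : ℂ)) = 0 := by
      simp only [modePoint]
      push_cast
      field_simp
      ring
    rw [h0] at h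
    change -(weilBrezin m (covY j τ) (modePoint k m)) = 0
    rw [h]
    simp⟩

/-! ### Decay of the fibrewise Fourier coefficients -/

theorem fibreFourier_eq (f : TorusFunction n) (p : Fin n → ℤ) (x : Fin n → ℝ) :
    fibreFourier f p x = weilBrezin (-p) f x := rfl

/-- The operator `1 - (2π)⁻² ∂²/∂(yʲ)²` on functions. -/
def dampOperator (j : Fin n) : Module.End ℂ (TorusFunction n) :=
  1 - ((4 * Real.pi ^ 2 : ℝ) : ℂ)⁻¹ • (covY j * covY j)

theorem weilBrezin_damp (p : Fin n → ℤ) (j : Fin n) (f : TorusFunction n) (x : Fin n → ℝ) :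
    weilBrezin (-p) (dampOperator j f) x = (1 + (p j : ℂ) ^ 2) * weilBrezin (-p) f x := by
  have h : dampOperator j f = f + (-((4 * Real.pi ^ 2 : ℝ) : ℂ)⁻¹) • covY j (covY j f) := by
    ext z
    simp [dampOperator, sub_eq_add_neg]
  rw [h, weilBrezin_add, weilBrezin_smul, weilBrezin_covY, weilBrezin_covY]
  have hpi : (Real.pi : ℂ) ≠ 0 := by exact_mod_cast Real.pi_ne_zero
  push_cast
  field_simp
  simp only [Pi.neg_apply, Int.cast_neg]
  ring_nf
  rw [Complex.I_sq]
  ring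

theorem weilBrezin_damp_prod (p : Fin n → ℤ) (l : List (Fin n)) (f : TorusFunction n)
    (x : Fin n → ℝ) : weilBrezin (-p) ((l.map dampOperator).prod f) x =
      (l.map fun j => 1 + (p j : ℂ) ^ 2).prod * weilBrezin (-p) f x := by
  induction l with
  | nil => simp
  | cons j l ih => simp [weilBrezin_damp, ih, mul_assoc]

theorem exists_norm_section_le (τ : lineSection n d) :
    ∃ B : ℝ, ∀ z, ‖(τ : Phase n → ℂ) z‖ ≤ B := by
  obtain ⟨B, hB⟩ := (isCompact_Icc.prod isCompact_Icc : IsCompact (cube n ×ˢ cube n)).exists_bound_of_continuousOn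
    (contDiff_section τ).continuous.continuousOn
  exact ⟨B, norm_section_le hB⟩

theorem exists_fibreFourier_le (f : TorusFunction n) :
    ∃ B : ℝ, ∀ p x, ‖fibreFourier f p x‖ ≤ B * ∏ j, (1 + (p j : ℝ) ^ 2)⁻¹ := by
  obtain ⟨B, hB⟩ := exists_norm_section_le (((List.finRange n).map dampOperator).prod f)
  refine ⟨B, fun p x => ?_⟩
  have h1 := norm_weilBrezin_le hB (-p) x
  have h2 : ((List.finRange n).map fun j => 1 + (p j : ℂ) ^ 2).prod =
      ((∏ j, (1 + (p j : ℝ) ^ 2) : ℝ) : ℂ) := by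
    rw [← List.ofFn_eq_map, List.prod_ofFn]
    push_cast
    rfl
  have h3 : (0 : ℝ) < ∏ j, (1 + (p j : ℝ) ^ 2) := Finset.prod_pos fun j _ => by positivity
  rw [weilBrezin_damp_prod, h2, norm_mul, Complex.norm_real, Real.norm_of_nonneg h3.le] at h1
  rw [fibreFourier_eq, Finset.prod_inv_distrib, ← div_eq_mul_inv, le_div_iff₀ h3]
  linarith

theorem summable_prod_inv (n : ℕ) :
    Summable fun p : Fin n → ℤ => ∏ j, (1 + (p j : ℝ) ^ 2)⁻¹ := by
  have h1 : Summable fun p : ℤ => (1 + (p : ℝ) ^ 2)⁻¹ := by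
    refine Summable.of_norm_bounded_eventually
      ((Real.summable_one_div_int_pow (p := 2)).2 one_lt_two) ?_
    filter_upwards [(Set.finite_singleton (0 : ℤ)).compl_mem_cofinite] with p hp
    have hp' : (0 : ℝ) < (p : ℝ) ^ 2 := by
      have : (p : ℝ) ≠ 0 := by exact_mod_cast hp
      positivity
    rw [Real.norm_of_nonneg (by positivity), one_div]
    gcongr
    linarith
  induction n with
  | zero => exact Summable.of_finite
  | succ n ih =>
    have h2 := h1.mul_of_nonneg ih (fun p => by positivity)
      (fun p => Finset.prod_nonneg fun j _ => by positivity)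
    rw [← (Fin.consEquiv fun _ : Fin (n + 1) => ℤ).summable_iff]
    refine h2.congr fun p => ?_
    simp [Fin.prod_univ_succ, mul_comm]

theorem summable_norm_fibreFourier (f : TorusFunction n) (x : (Fin n → ℤ) → Fin n → ℝ) :
    Summable fun p => ‖fibreFourier f p (x p)‖ := by
  obtain ⟨B, hB⟩ := exists_fibreFourier_le f
  exact Summable.of_nonneg_of_le (fun p => norm_nonneg _) (fun p => hB p (x p))
    ((summable_prod_inv n).mul_left B)

/-! ### The Toeplitz-type operator -/

theorem norm_toeplitz_term_le (f : TorusFunction n) (k : ℕ+) (m : Fin n → ℤ)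
    {τ : lineSection n (-((k : ℕ) : ℤ))} {B : ℝ} (h : ∀ z, ‖(τ : Phase n → ℂ) z‖ ≤ B)
    (p : Fin n → ℤ) :
    ‖fibreFourier f p (modePoint k (m + p)) * weilBrezin (m + p) τ (modePoint k (m + p))‖ ≤
      ‖fibreFourier f p (modePoint k (m + p))‖ * B := by
  rw [norm_mul]
  gcongr
  exact norm_weilBrezin_le h _ _

theorem summable_toeplitz_term (f : TorusFunction n) (k : ℕ+) (m : Fin n → ℤ)
    (τ : lineSection n (-((k : ℕ) : ℤ))) :
    Summable fun p : Fin n → ℤ =>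
      fibreFourier f p (modePoint k (m + p)) * weilBrezin (m + p) τ (modePoint k (m + p)) := by
  obtain ⟨B, hB⟩ := exists_norm_section_le τ
  exact Summable.of_norm_bounded ((summable_norm_fibreFourier f _).mul_right B)
    (norm_toeplitz_term_le f k m hB)

/-- The polarized distributional section `T_{f,k} σ_k^{[m]}`:
`⟨T_{f,k} σ_k^{[m]}, τ⟩ = ∑_{p ∈ ℤⁿ} (f̂_p · τ̃_{m+p})((m+p)/k)`. -/
def toeplitzSigma (f : TorusFunction n) (k : ℕ+) (m : Fin n → ℤ) :
    polarizedSection n (k : ℕ) :=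
  ⟨⟨{ toFun := fun τ => ∑' p : Fin n → ℤ,
        fibreFourier f p (modePoint k (m + p)) * weilBrezin (m + p) τ (modePoint k (m + p))
      map_add' := fun σ τ => by
        rw [← (summable_toeplitz_term f k m σ).tsum_add (summable_toeplitz_term f k m τ)]
        simp only [weilBrezin_add, mul_add]
      map_smul' := fun c τ => by
        rw [RingHom.id_apply, smul_eq_mul, ← tsum_mul_left]
        congr 1
        funext p
        rw [weilBrezin_smul]
        ring },
    ⟨cube n ×ˢ cube n, 0, ∑' p, ‖fibreFourier f p (modePoint k (m + p))‖,
      isCompact_Icc.prod isCompact_Icc, fun τ B _ h => by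
        rw [← tsum_mul_right]
        exact tsum_of_norm_bounded ((summable_norm_fibreFourier f _).mul_right B).hasSum
          (norm_toeplitz_term_le f k m (boundedOn_cube_norm_le h))⟩⟩, by
    simp only [polarizedSection, Submodule.mem_iInf, LinearMap.mem_ker]
    intro j
    apply Subtype.ext
    apply LinearMap.ext
    intro τ
    change -(∑' p : Fin n → ℤ, fibreFourier f p (modePoint k (m + p)) *
      weilBrezin (m + p) (covY j τ) (modePoint k (m + p))) = 0
    have h : ∀ p, weilBrezin (m + p) (covY j τ) (modePoint k (m + p)) = 0 := by
      intro p
      have h1 := (sigma k (m + p)).2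
      simp only [polarizedSection, Submodule.mem_iInf, LinearMap.mem_ker] at h1
      have h2 : -(weilBrezin (m + p) (covY j τ) (modePoint k (m + p))) = 0 :=
        congrArg (fun s : distSection n (k : ℕ) => s.1 τ) (h1 j)
      simpa using h2
    simp [h]⟩

/-- The linear combinations `∑_{[m]} c_{[m]} σ_k^{[m]}`; the classes `[m] ∈ (ℤ/kℤ)ⁿ` are represented
by `{0, …, k-1}ⁿ`. -/
def combination (n : ℕ) (k : ℕ+) :
    ((Fin n → Fin k) → ℂ) →ₗ[ℂ] polarizedSection n (k : ℕ) :=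
  Fintype.linearCombination ℂ fun m : Fin n → Fin k => sigma k fun i => ((m i : ℕ) : ℤ)

/-- Test sections dual to the `σ_k^{[m]}`. -/
theorem exists_dual_testSection (k : ℕ+) (m₀ : Fin n → Fin k) :
    ∃ τ : lineSection n (-((k : ℕ) : ℤ)), ∀ m : Fin n → Fin k,
      (sigma k fun i => ((m i : ℕ) : ℤ)).1.1 τ = if m = m₀ then 1 else 0 := by
  have hk : (0 : ℝ) < (k : ℝ) := by exact_mod_cast k.pos
  set M : Fin n → ℤ := fun i => ((m₀ i : ℕ) : ℤ) with hM
  let φ : ContDiffBump (modePoint k M) := ⟨1 / (2 * k), 1 / k, by positivity, by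
    rw [div_lt_div_iff₀ (by positivity) hk]; linarith⟩
  let term : (Fin n → ℤ) → Phase n → ℂ := fun q z =>
    ((φ (z.1 + intVec q) : ℝ) : ℂ) * character (-M + ((k : ℕ) : ℤ) • q) z.2
  have hterm : ∀ q, ContDiff ℝ ∞ (term q) := fun q =>
    (Complex.ofRealCLM.contDiff.comp (φ.contDiff.comp (contDiff_fst.add contDiff_const))).mul
      ((contDiff_character _).comp contDiff_snd)
  have hzero : ∀ q (z : Phase n), term q z ≠ 0 → ∀ i, |z.1 i + q i - modePoint k M i| < 1 / k := by
    intro q z hz i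
    have h1 : φ (z.1 + intVec q) ≠ 0 := by
      intro h
      exact hz (by simp [term, h])
    have h2 : z.1 + intVec q ∈ Metric.ball (modePoint k M) (1 / k) := by
      rw [← φ.support_eq]
      exact h1
    have h3 := (dist_pi_lt_iff (by positivity)).1 (Metric.mem_ball.1 h2) i
    simpa [Real.dist_eq, intVec] using h3
  have hsmooth : ContDiff ℝ ∞ fun z => ∑' q, term q z := by
    rw [contDiff_iff_contDiffAt]
    intro z₀
    let R : Fin n → ℤ := fun i => ⌈|z₀.1 i| + 1 + |modePoint k M i| + 1 / (k : ℝ)⌉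
    have hloc : (fun z => ∑' q, term q z) =ᶠ[nhds z₀]
        fun z => ∑ q ∈ Finset.Icc (-R) R, term q z := by
      filter_upwards [Metric.ball_mem_nhds z₀ one_pos] with z hz
      refine tsum_eq_sum fun q hq => ?_
      by_contra hne
      refine hq ?_
      have h1 : ∀ i, |(q i : ℝ)| ≤ R i := by
        intro i
        have h2 := hzero q z hne i
        have h3 : |z.1 i - z₀.1 i| < 1 := by
          have h4 : dist z.1 z₀.1 < 1 := lt_of_le_of_lt (le_max_left _ _) (Metric.mem_ball.1 hz)
          simpa [Real.dist_eq] using (dist_pi_lt_iff one_pos).1 h4 i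
        have h5 : |(q i : ℝ)| ≤ |z₀.1 i| + 1 + |modePoint k M i| + 1 / (k : ℝ) := by
          have := abs_lt.1 h2
          have := abs_lt.1 h3
          have := neg_abs_le (z₀.1 i)
          have := le_abs_self (z₀.1 i)
          have := neg_abs_le (modePoint k M i)
          have := le_abs_self (modePoint k M i)
          rw [abs_le]
          constructor <;> linarith
        exact h5.trans (Int.le_ceil _)
      rw [Finset.mem_Icc]
      refine ⟨fun i => ?_, fun i => ?_⟩
      · have := (abs_le.1 (h1 i)).1
        simp only [Pi.neg_apply]
        exact_mod_cast this
      · exact_mod_cast (abs_le.1 (h1 i)).2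
    exact (ContDiff.sum fun q _ => hterm q).contDiffAt.congr_of_eventuallyEq hloc
  let τ : lineSection n (-((k : ℕ) : ℤ)) := ⟨fun z => ∑' q, term q z, hsmooth, by
    intro μ ν x y
    simp only
    rw [← (Equiv.subRight μ).tsum_eq, ← tsum_mul_left]
    congr 1
    funext q
    have h1 : x + intVec μ + intVec (q - μ) = x + intVec q := by
      funext i
      simp [intVec]
    have h2 : character (-M + ((k : ℕ) : ℤ) • (q - μ)) (y + intVec ν) =
        character (-((k : ℕ) : ℤ) • μ) y * character (-M + ((k : ℕ) : ℤ) • q) y := by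
      unfold character
      rw [← Complex.exp_add, Complex.exp_eq_exp_iff_exists_int]
      refine ⟨∑ i, (-M + ((k : ℕ) : ℤ) • (q - μ)) i * ν i, ?_⟩
      push_cast
      rw [← mul_add, ← Finset.sum_add_distrib, mul_comm (∑ i, _) (2 * _ * _), ← mul_add,
        ← Finset.sum_add_distrib]
      congr 1
      refine Finset.sum_congr rfl fun i _ => ?_
      simp [intVec]
      ring
    simp only [term, Equiv.subRight_apply, h1, h2]
    ring⟩
  refine ⟨τ, fun m => ?_⟩
  change weilBrezin (fun i => ((m i : ℕ) : ℤ)) τ (modePoint k fun i => ((m i : ℕ) : ℤ)) = _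
  have hq : ∀ (q : Fin n → ℤ) y, term q (modePoint k fun i => ((m i : ℕ) : ℤ), y) ≠ 0 →
      m = m₀ ∧ q = 0 := by
    intro q y hne
    have h1 : ∀ i, ((m i : ℕ) : ℤ) + k * q i - ((m₀ i : ℕ) : ℤ) = 0 := by
      intro i
      have h2 := hzero q _ hne i
      simp only [modePoint, hM] at h2
      have h3 : ((((m i : ℕ) : ℤ) : ℝ) / k + q i - (((m₀ i : ℕ) : ℤ) : ℝ) / k) =
          ((((m i : ℕ) : ℤ) + k * q i - ((m₀ i : ℕ) : ℤ) : ℤ) : ℝ) / k := by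
        push_cast
        field_simp
      rw [h3, abs_div, abs_of_pos hk, div_lt_div_iff_of_pos_right hk] at h2
      rw [← Int.abs_lt_one_iff]
      exact_mod_cast h2
    have h4 : ∀ i, q i = 0 := by
      intro i
      have h5 := h1 i
      have h6 : ((m i : ℕ) : ℤ) < k := by exact_mod_cast (m i).2
      have h7 : ((m₀ i : ℕ) : ℤ) < k := by exact_mod_cast (m₀ i).2
      have h8 : (0 : ℤ) < k := by exact_mod_cast k.pos
      by_contra h9
      rcases lt_or_gt_of_ne h9 with h | h
      · nlinarith
      · nlinarith
    refine ⟨?_, funext h4⟩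
    funext i
    have h5 := h1 i
    rw [h4 i] at h5
    apply Fin.ext
    omega
  unfold weilBrezin
  by_cases h : m = m₀
  · rw [if_pos h]
    subst h
    have h1 : ∀ y, character M y * ∑' q, term q (modePoint k M, y) = 1 := by
      intro y
      rw [tsum_eq_single 0 (fun q hne => by
        by_contra h
        exact hne (hq q y h).2)]
      have h2 : modePoint k M + intVec (0 : Fin n → ℤ) = modePoint k M := by
        funext i
        simp [intVec]
      have h3 : φ (modePoint k M) = 1 := φ.one_of_mem_closedBall (by simp [φ.rIn_pos.le])
      simp only [term, h2, h3, smul_zero, add_zero]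
      simp [character, ← Complex.exp_add]
    have h2 : MeasureTheory.volume.real (cube n) = 1 := by
      rw [MeasureTheory.Measure.real, cube, Real.volume_Icc_pi]
      simp
    change ∫ y in cube n, character M y * ∑' q, term q (modePoint k M, y) = 1
    simp [h1, h2]
  · rw [if_neg h]
    have h1 : ∀ y, (τ : Phase n → ℂ) (modePoint k fun i => ((m i : ℕ) : ℤ), y) = 0 := by
      intro y
      change ∑' q, term q (modePoint k fun i => ((m i : ℕ) : ℤ), y) = 0
      have : ∀ q, term q (modePoint k fun i => ((m i : ℕ) : ℤ), y) = 0 := by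
        intro q
        by_contra hne
        exact h (hq q y hne).1
      simp [this]
    simp [h1]

theorem combination_apply (k : ℕ+) (c : (Fin n → Fin k) → ℂ)
    (τ : lineSection n (-((k : ℕ) : ℤ))) : (combination n k c).1.1 τ =
      ∑ m, c m * (sigma k fun i => ((m i : ℕ) : ℤ)).1.1 τ := by
  simp [combination, Fintype.linearCombination_apply]

/-- The sections `σ_k^{[m]}` are linearly independent. -/
theorem ker_combination (n : ℕ) (k : ℕ+) : LinearMap.ker (combination n k) = ⊥ := by
  rw [LinearMap.ker_eq_bot']
  intro c hc
  funext m₀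
  obtain ⟨τ, hτ⟩ := exists_dual_testSection k m₀
  have h := combination_apply k c τ
  rw [hc] at h
  simpa [hτ] using h.symm

/-- The coefficients `s_{[m]}` of a polarized distributional section with respect to the basis
`σ_k^{[m]}`: the inverse of `c ↦ ∑ c_{[m]} σ_k^{[m]}`, which is injective by `ker_combination`. -/
def coefficients (n : ℕ) (k : ℕ+) :
    polarizedSection n (k : ℕ) →ₗ[ℂ] ((Fin n → Fin k) → ℂ) :=
  LinearMap.leftInverse (K := ℂ) (V := (Fin n → Fin k) → ℂ) (V' := polarizedSection n (k : ℕ))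
    (combination n k)

/-- The Toeplitz-type operator `T_{f,k}` on polarized distributional sections, given on the basis
`σ_k^{[m]}` by `toeplitzSigma`. -/
def toeplitz (f : TorusFunction n) (k : ℕ+) :
    polarizedSection n (k : ℕ) →ₗ[ℂ] polarizedSection n (k : ℕ) :=
  (Fintype.linearCombination ℂ
    fun m : Fin n → Fin k => toeplitzSigma f k fun i => ((m i : ℕ) : ℤ)) ∘ₗ coefficients n k

/-- The `ℓ¹`-norm `‖s‖_{ℓ¹} = ∑_{[m]} |s_{[m]}|`. -/
def l1Norm {k : ℕ+} (s : polarizedSection n (k : ℕ)) : ℝ :=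
  ∑ m, ‖coefficients n k s m‖

/-- The norm `‖τ‖_N`: the supremum of `|∂^r τ̃_m / ∂x^{i₁} ⋯ ∂x^{i_r} (x)|` over `m`, `r ≤ N`,
`i₁, …, i_r` and `x ∈ ℝⁿ`. Since `τ̃_{m+kq}(x) = τ̃_m(x - q)`, all `m` in a class `[m]` contribute the
same values. -/
def testNorm {k : ℕ+} (N : ℕ) (τ : lineSection n (-((k : ℕ) : ℤ))) : ℝ :=
  sSup {a : ℝ | ∃ (m : Fin n → ℤ) (r : ℕ) (i : Fin r → Fin n) (x : Fin n → ℝ), r ≤ N ∧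
    a = ‖iteratedFDeriv ℝ r (weilBrezin m τ) x fun l => Pi.single (i l) 1‖}

theorem coefficients_combination (k : ℕ+) (c : (Fin n → Fin k) → ℂ) :
    coefficients n k (combination n k c) = c :=
  LinearMap.leftInverse_apply_of_inj (ker_combination n k) c

theorem toeplitz_sigma (f : TorusFunction n) (k : ℕ+) (m : Fin n → Fin k) :
    toeplitz f k (sigma k fun i => ((m i : ℕ) : ℤ)) =
      toeplitzSigma f k fun i => ((m i : ℕ) : ℤ) := by
  classical
  have h : sigma k (fun i => ((m i : ℕ) : ℤ)) = combination n k (Pi.single m 1) := by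
    simp [combination]
  rw [h, toeplitz, LinearMap.comp_apply, coefficients_combination]
  simp

/-! ### The formal Weyl bundle, quantum jets and their action -/

theorem covX_comm (i j : Fin n) :
    Commute (covX i : Module.End ℂ (lineSection n d)) (covX j) := by
  refine LinearMap.ext fun τ => ?_
  ext z
  have h1 : Differentiable ℝ (fderiv ℝ (τ : Phase n → ℂ)) :=
    ((contDiff_section τ).fderiv_right (m := ∞) (by simp)).differentiable (by simp)
  have h2 : IsSymmSndFDerivAt ℝ (τ : Phase n → ℂ) z :=
    (contDiff_section τ).contDiffAt.isSymmSndFDerivAt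
      (by rw [minSmoothness_of_isRCLikeNormedField]; exact ENat.LEInfty.out)
  simp only [Module.End.mul_apply, covX, LinearMap.coe_mk, AddHom.coe_mk]
  rw [fderiv_clm_apply (h1 z) (differentiableAt_const _),
    fderiv_clm_apply (h1 z) (differentiableAt_const _)]
  simpa using h2.eq _ _

theorem covY_function (j : Fin n) (f : TorusFunction n) (z : Phase n) :
    ((covY j f : TorusFunction n) : Phase n → ℂ) z =
      fderiv ℝ (f : Phase n → ℂ) z (0, Pi.single j 1) := by
  simp [covY]

theorem covY_comm (i j : Fin n) :
    Commute (covY i : Module.End ℂ (TorusFunction n)) (covY j) := by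
  refine LinearMap.ext fun τ => ?_
  ext z
  have h1 : Differentiable ℝ (fderiv ℝ (τ : Phase n → ℂ)) :=
    ((contDiff_section τ).fderiv_right (m := ∞) (by simp)).differentiable (by simp)
  have h2 : IsSymmSndFDerivAt ℝ (τ : Phase n → ℂ) z :=
    (contDiff_section τ).contDiffAt.isSymmSndFDerivAt
      (by rw [minSmoothness_of_isRCLikeNormedField]; exact ENat.LEInfty.out)
  have h3 : ∀ i : Fin n, ((covY i τ : TorusFunction n) : Phase n → ℂ) =
      fun z => fderiv ℝ (τ : Phase n → ℂ) z (0, Pi.single i 1) :=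
    fun i => funext (covY_function i τ)
  simp only [Module.End.mul_apply, covY_function, h3]
  rw [fderiv_clm_apply (h1 z) (differentiableAt_const _),
    fderiv_clm_apply (h1 z) (differentiableAt_const _)]
  simpa using h2.eq _ _

theorem covX_covY_comm (i j : Fin n) :
    Commute (covX i : Module.End ℂ (TorusFunction n)) (covY j) := by
  refine LinearMap.ext fun τ => ?_
  ext z
  have h1 : Differentiable ℝ (fderiv ℝ (τ : Phase n → ℂ)) :=
    ((contDiff_section τ).fderiv_right (m := ∞) (by simp)).differentiable (by simp)
  have h2 : IsSymmSndFDerivAt ℝ (τ : Phase n → ℂ) z :=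
    (contDiff_section τ).contDiffAt.isSymmSndFDerivAt
      (by rw [minSmoothness_of_isRCLikeNormedField]; exact ENat.LEInfty.out)
  have h3 : ∀ i : Fin n, ((covY i τ : TorusFunction n) : Phase n → ℂ) =
      fun z => fderiv ℝ (τ : Phase n → ℂ) z (0, Pi.single i 1) :=
    fun i => funext (covY_function i τ)
  simp only [Module.End.mul_apply, covY_function, covX, LinearMap.coe_mk, AddHom.coe_mk, h3]
  rw [fderiv_clm_apply (h1 z) (differentiableAt_const _),
    fderiv_clm_apply (h1 z) (differentiableAt_const _)]
  simpa using h2.eq _ _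

/-- The composition `A_{i₁} ∘ ⋯ ∘ A_{i_r}`. -/
def iterateOperator {E : Type*} [AddCommGroup E] [Module ℂ E] (A : Fin n → Module.End ℂ E)
    {r : ℕ} (i : Fin r → Fin n) : Module.End ℂ E :=
  (List.ofFn fun l => A (i l)).prod

theorem iterateOperator_cons {E : Type*} [AddCommGroup E] [Module ℂ E]
    (A : Fin n → Module.End ℂ E) {r : ℕ} (j : Fin n) (i : Fin r → Fin n) :
    iterateOperator A (Fin.cons j i : Fin (r + 1) → Fin n) = A j * iterateOperator A i := by
  simp [iterateOperator]

theorem iterateOperator_comm {E : Type*} [AddCommGroup E] [Module ℂ E]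
    {A : Fin n → Module.End ℂ E} {B : Module.End ℂ E} (h : ∀ i, Commute B (A i)) {r : ℕ}
    (i : Fin r → Fin n) : Commute B (iterateOperator A i) :=
  Commute.list_prod_right _ _ fun x hx => by
    obtain ⟨l, rfl⟩ := (List.mem_ofFn' _ _).1 hx
    exact h _

theorem iterateOperator_perm {E : Type*} [AddCommGroup E] [Module ℂ E]
    {A : Fin n → Module.End ℂ E} (h : ∀ i j, Commute (A i) (A j)) {r : ℕ}
    (i : Fin r → Fin n) (π : Equiv.Perm (Fin r)) :
    iterateOperator A (i ∘ π) = iterateOperator A i := by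
  refine List.Perm.prod_eq' (π.ofFn_comp_perm fun l => A (i l)) ?_
  rw [List.pairwise_ofFn]
  exact fun _ _ _ => h _ _

/-- Sections of the Weyl bundle `𝒲 = Ŝym T*M_ℂ[[ħ]]` over the torus, in the global frame
`u¹, …, uⁿ` of `Q*` and `ǔ¹, …, ǔⁿ` of `P*`: the family of coefficients represents
`∑_{q,p,l} ħˡ ∑_{i,j} a_{q,p,l,i,j} u^{i₁} ⋯ u^{i_q} ǔ^{j₁} ⋯ ǔ^{j_p}`, and it is symmetric in `i`
and in `j`. -/
@[ext]
structure WeylSection (n : ℕ) where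
  coeff : ∀ (q p : ℕ), ℕ → (Fin q → Fin n) → (Fin p → Fin n) → TorusFunction n
  symm_left : ∀ q p l i j (π : Equiv.Perm (Fin q)), coeff q p l (i ∘ π) j = coeff q p l i j
  symm_right : ∀ q p l i j (π : Equiv.Perm (Fin p)), coeff q p l i (j ∘ π) = coeff q p l i j

/-- Flatness for the Fedosov connection, which on the torus is `D = d - δ` with
`δ = ∑ dxⁱ ∂/∂uⁱ + ∑ dyʲ ∂/∂ǔʲ`. -/
def WeylSection.IsFlat (a : WeylSection n) : Prop :=
  ∀ (q p l : ℕ) (i : Fin q → Fin n) (j : Fin p → Fin n),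
    (∀ e : Fin n, covX e (a.coeff q p l i j) -
      ((q : ℂ) + 1) • a.coeff (q + 1) p l (Fin.cons e i : Fin (q + 1) → Fin n) j = 0) ∧
    (∀ e : Fin n, covY e (a.coeff q p l i j) -
      ((p : ℂ) + 1) • a.coeff q (p + 1) l i (Fin.cons e j : Fin (p + 1) → Fin n) = 0)

/-- The component of `a` in `C^∞(M)[[ħ]]` is `f`. -/
def WeylSection.HasSymbol (a : WeylSection n) (f : TorusFunction n) : Prop :=
  ∀ (l : ℕ) (i j : Fin 0 → Fin n), a.coeff 0 0 l i j = if l = 0 then f else 0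

/-- The quantum jet `𝐉_f` of a function `f`, i.e. the flat section of the Weyl bundle with
component `f`; here it is the fibrewise Taylor series of `f`. -/
def quantumJet (f : TorusFunction n) : WeylSection n where
  coeff q p l i j := if l = 0 then ((q.factorial : ℂ) * p.factorial)⁻¹ •
    iterateOperator covX i (iterateOperator covY j f) else 0
  symm_left q p l i j π := by rw [iterateOperator_perm covX_comm]
  symm_right q p l i j π := by rw [iterateOperator_perm covY_comm]

theorem isFlat_quantumJet (f : TorusFunction n) : (quantumJet f).IsFlat := by
  intro q p l i j
  by_cases hl : l = 0
  · subst hl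
    simp only [quantumJet, if_true, iterateOperator_cons, Module.End.mul_apply]
    constructor
    · intro e
      rw [smul_smul, map_smul, Nat.factorial_succ, sub_eq_zero]
      congr 1
      have : (q : ℂ) + 1 ≠ 0 := by exact_mod_cast q.succ_ne_zero
      push_cast
      field_simp
    · intro e
      have h : covY e (iterateOperator covX i (iterateOperator covY j f)) =
          iterateOperator covX i (covY e (iterateOperator covY j f)) :=
        LinearMap.congr_fun (iterateOperator_comm (fun e' => (covX_covY_comm e' e).symm) i)
          (iterateOperator covY j f)
      rw [smul_smul, map_smul, Nat.factorial_succ, sub_eq_zero, h]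
      congr 1
      have : (p : ℂ) + 1 ≠ 0 := by exact_mod_cast p.succ_ne_zero
      push_cast
      field_simp
  · simp [quantumJet, hl]

theorem hasSymbol_quantumJet (f : TorusFunction n) : (quantumJet f).HasSymbol f := by
  intro l i j
  by_cases hl : l = 0
  · simp [quantumJet, hl, iterateOperator]
  · simp [quantumJet, hl]

/-- A flat section of the Weyl bundle is determined by its component in `C^∞(M)[[ħ]]`. -/
theorem eq_quantumJet {a : WeylSection n} {f : TorusFunction n} (ha : a.IsFlat)
    (hf : a.HasSymbol f) : a = quantumJet f := by
  have hb := isFlat_quantumJet f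
  have hg := hasSymbol_quantumJet f
  have hc : ∀ q : ℕ, (q : ℂ) + 1 ≠ 0 := fun q => by exact_mod_cast q.succ_ne_zero
  have key : ∀ q p l i j, a.coeff q p l i j = (quantumJet f).coeff q p l i j := by
    intro q
    induction q with
    | zero =>
      intro p
      induction p with
      | zero => intro l i j; rw [hf, hg]
      | succ p ih =>
        intro l i j
        have h1 := sub_eq_zero.1 ((ha 0 p l i (Fin.tail j)).2 (j 0))
        have h2 := sub_eq_zero.1 ((hb 0 p l i (Fin.tail j)).2 (j 0))
        rw [Fin.cons_self_tail] at h1 h2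
        rw [ih, h2] at h1
        exact (smul_right_injective _ (hc p) h1).symm
    | succ q ih =>
      intro p l i j
      have h1 := sub_eq_zero.1 ((ha q p l (Fin.tail i) j).1 (i 0))
      have h2 := sub_eq_zero.1 ((hb q p l (Fin.tail i) j).1 (i 0))
      rw [Fin.cons_self_tail] at h1 h2
      rw [ih, h2] at h1
      exact (smul_right_injective _ (hc q) h1).symm
  exact WeylSection.ext (by funext q p l i j; exact key q p l i j)

/-- The action `(a)_r ⊛_k` on distributional sections of `L^{⊗k}` of the component `(a)_r` of
polarized weight `r` of `a` (`ǔʲ` and `ħ` have weight `1`, `uⁱ` has weight `0`): the component of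
`(a)_r` in `Sym P*[ħ]`, which is the sum over `p ≤ r` of the terms with `ħ^{r-p}` and `p` factors
`ǔʲ`, acts with `ħ = √-1/k` and with `ǔʲ` replaced by
`(√-1/k) ω^{ǰj} ∇_{∂/∂xʲ}`, where `ω^{ǰj} = 1/(2π)`. -/
def WeylSection.weightAction (a : WeylSection n) (k : ℕ+) (r : ℕ) :
    distSection n (k : ℕ) →ₗ[ℂ] distSection n (k : ℕ) :=
  ∑ p ∈ Finset.range (r + 1),
    ((Complex.I / (k : ℂ)) ^ (r - p) * (Complex.I / (k : ℂ) * (2 * (Real.pi : ℂ))⁻¹) ^ p) •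
      ∑ j : Fin p → Fin n, distMul (a.coeff 0 p (r - p) Fin.elim0 j) ∘ₗ iterateOperator distCovX j

/-- The operator `T_{f,r,k} = (𝐉_f)_r ⊛_k` on distributional sections of `L^{⊗k}`. -/
def weightToeplitz (f : TorusFunction n) (r : ℕ) (k : ℕ+) :
    distSection n (k : ℕ) →ₗ[ℂ] distSection n (k : ℕ) :=
  (quantumJet f).weightAction k r

end SymplecticTorus

end

open SymplecticTorus

open scoped ContDiff

noncomputable section

namespace SymplecticTorus

open MeasureTheory

variable {n : ℕ} {d : ℤ}

/-! ### Integrals depending smoothly on a parameter -/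

section Parametric

variable {T E G : Type} [NormedAddCommGroup T] [NormedSpace ℝ T] [MeasurableSpace T] [BorelSpace T]
  [NormedAddCommGroup E] [NormedSpace ℝ E] [LocallyCompactSpace E]
  {μ : Measure T} [IsLocallyFiniteMeasure μ]

/-! For `s = σ_k^{[m]}` the theorem is Taylor's formula summed over Fourier modes. Put `h_p = f̂_p
τ̃_{m+p}`. By definition `⟨T_{f,k} σ_k^{[m]}, τ⟩ = ∑_p h_p(m/k + p/k)`. Expanding `h_p` at `m/k`,
the term of order `r` is `D^r h_p(m/k)(p/k, …, p/k) / r!`, and its sum over `p` is exactly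
`⟨T_{f,r,k} σ_k^{[m]}, τ⟩` (`hasSum_weightToeplitz_sigma`). Indeed, each `∂/∂yʲ` on `f` multiplies
`f̂_p` by `2πi p_j`, each weak `∇_{∂/∂xʲ}` puts an `x`-derivative with a minus sign on the product
with `τ`, and the `m`-th Weil–Brezin coefficient of `f τ` is `∑_p f̂_p τ̃_{m+p}`
(`hasSum_weilBrezin_mulFunction`). The scalars combine to `k^{-r}`.

The remainder for the mode `p` is at most `sup ‖D^{N+1} h_p‖ |p/k|^{N+1}`. As `f` is smooth, `f̂_p`
and its `x`-derivatives decay faster than any power of `p`, uniformly in `x`. This absorbs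
`|p|^{N+1}` and leaves a summable weight, with a constant independent of `k` and `m`
(`exists_iteratedFDeriv_modeProduct_le`).

A general `s` is treated by linearity, which requires that the `σ_k^{[m]}` span the polarized
sections (`exists_eq_combination`). A polarized `s` annihilates all `∇_{∂/∂yʲ} τ`. Parallel
transport around a leaf circle in direction `yʲ` has holonomy `e^{2πi k xʲ}` on test sections, and
integrating the transport equation shows that `(e^{2πi k xʲ} - 1) τ` is a covariant derivative. By
Hadamard's lemma every section vanishing where `k xʲ ∈ ℤ` has this form, so `s` sees only the
restriction of `τ` to the Bohr–Sommerfeld fibres `x ∈ (1/k)ℤⁿ`. Averaging over the leaves does not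
change `⟨s, τ⟩` and makes `τ` covariantly constant on these fibres, where a single number
`τ̃_m(m/k)` determines it. -/

theorem hasFDerivAt_setIntegral_param [NormedAddCommGroup G] [NormedSpace ℝ G]
    {F : E → T → G} (hF : ContDiff ℝ ∞ F.uncurry) {K : Set T} (hK : IsCompact K) (z : E) :
    HasFDerivAt (fun z => ∫ t in K, F z t ∂μ)
      (∫ t in K, (fderiv ℝ F.uncurry (z, t)).comp (ContinuousLinearMap.inl ℝ E T) ∂μ) z := by
  have hd : Differentiable ℝ F.uncurry := hF.differentiable (by simp)
  have hc : Continuous fun q : E × T =>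
      (fderiv ℝ F.uncurry q).comp (ContinuousLinearMap.inl ℝ E T) :=
    (hF.continuous_fderiv (by simp)).clm_comp continuous_const
  have hFz : ∀ z, Continuous (F z) := fun z =>
    hF.continuous.comp (f := fun t => (z, t)) (by fun_prop)
  have hcz : ∀ z, Continuous fun t : T =>
      (fderiv ℝ F.uncurry (z, t)).comp (ContinuousLinearMap.inl ℝ E T) := fun z =>
    hc.comp (f := fun t => (z, t)) (by fun_prop)
  -- Local compactness gives a compact neighbourhood `U`. On `U ×ˢ K` the derivative is bounded by a
  -- constant, which is integrable over `K` and serves as the dominating function.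
  obtain ⟨U, hU, hUz⟩ := exists_compact_mem_nhds z
  obtain ⟨C, hC⟩ := (hU.prod hK).exists_bound_of_continuousOn hc.continuousOn
  refine hasFDerivAt_integral_of_dominated_of_fderiv_le (𝕜 := ℝ) (bound := fun _ => C) hUz
    (F' := fun z t => (fderiv ℝ F.uncurry (z, t)).comp (ContinuousLinearMap.inl ℝ E T)) ?_
    ((hFz z).continuousOn.integrableOn_compact hK)
    ((hcz z).continuousOn.integrableOn_compact hK).aestronglyMeasurable ?_
    (continuousOn_const.integrableOn_compact hK) ?_
  · exact Filter.Eventually.of_forall fun z =>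
      ((hFz z).continuousOn.integrableOn_compact hK).aestronglyMeasurable
  · filter_upwards [ae_restrict_mem hK.measurableSet] with t ht x hx using hC (x, t) ⟨hx, ht⟩
  · refine Filter.Eventually.of_forall fun t x _ => ?_
    exact (hd (x, t)).hasFDerivAt.comp (f := fun e => (e, t)) x (hasFDerivAt_prodMk_left x t)

theorem contDiff_setIntegral_param [NormedAddCommGroup G] [NormedSpace ℝ G]
    {F : E → T → G} (hF : ContDiff ℝ ∞ F.uncurry) {K : Set T} (hK : IsCompact K) :
    ContDiff ℝ ∞ (fun z => ∫ t in K, F z t ∂μ) := by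
  refine contDiff_infty.2 fun r => ?_
  -- The derivative is again a parametric integral, but with values in `E →L[ℝ] G`, so the target
  -- space has to vary in the induction.
  induction r generalizing G with
  | zero =>
    rw [Nat.cast_zero, contDiff_zero]
    exact continuous_iff_continuousAt.2 fun z =>
      (hasFDerivAt_setIntegral_param hF hK z).continuousAt
  | succ r ih =>
    rw [Nat.cast_succ, contDiff_succ_iff_fderiv]
    refine ⟨fun z => (hasFDerivAt_setIntegral_param hF hK z).differentiableAt, by simp, ?_⟩
    have h : fderiv ℝ (fun z => ∫ t in K, F z t ∂μ) = fun z => ∫ t in K,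
        (fderiv ℝ F.uncurry (z, t)).comp (ContinuousLinearMap.inl ℝ E T) ∂μ :=
      funext fun z => (hasFDerivAt_setIntegral_param hF hK z).fderiv
    rw [h]
    exact ih ((hF.fderiv_right (m := ∞) (by simp)).clm_comp contDiff_const)

theorem fderiv_setIntegral_param [NormedAddCommGroup G] [NormedSpace ℝ G]
    {F : E → T → G} (hF : ContDiff ℝ ∞ F.uncurry) {K : Set T} (hK : IsCompact K)
    (z v : E) :
    fderiv ℝ (fun z => ∫ t in K, F z t ∂μ) z v =
      ∫ t in K, fderiv ℝ F.uncurry (z, t) (v, 0) ∂μ := by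
  have hc : Continuous fun t : T =>
      (fderiv ℝ F.uncurry (z, t)).comp (ContinuousLinearMap.inl ℝ E T) :=
    ((hF.continuous_fderiv (by simp)).clm_comp continuous_const).comp
      (f := fun t => (z, t)) (by fun_prop)
  rw [(hasFDerivAt_setIntegral_param hF hK z).fderiv,
    ContinuousLinearMap.integral_apply (hc.continuousOn.integrableOn_compact hK)]
  simp

end Parametric


/-! ### Derivatives of Weil–Brezin coefficients -/

theorem contDiff_weilBrezin (m : Fin n → ℤ) (τ : lineSection n d) :
    ContDiff ℝ ∞ (weilBrezin m τ) := by
  refine contDiff_setIntegral_param (F := fun x y => character m y * (τ : Phase n → ℂ) (x, y)) ?_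
    isCompact_Icc
  exact ((contDiff_character m).comp contDiff_snd).mul (contDiff_section τ)

/-- Neither the character nor the connection form has a `dxⁱ` component to contribute, so
differentiating under the integral gives `covX` and nothing else. -/
theorem fderiv_weilBrezin (m : Fin n → ℤ) (τ : lineSection n d) (x : Fin n → ℝ) (i : Fin n) :
    fderiv ℝ (weilBrezin m τ) x (Pi.single i 1) = weilBrezin m (covX i τ) x := by
  have h : ContDiff ℝ ∞ (Function.uncurry
      fun x y : Fin n → ℝ => character m y * (τ : Phase n → ℂ) (x, y)) :=
    ((contDiff_character m).comp contDiff_snd).mul (contDiff_section τ)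
  refine (fderiv_setIntegral_param h isCompact_Icc x _).trans ?_
  unfold weilBrezin
  congr 1
  funext y
  obtain ⟨D, hD, -⟩ := hasFDerivAt_character m y
  have h1 := (hD.comp (x, y) (hasFDerivAt_snd (𝕜 := ℝ) (p := (x, y)))).mul
    ((contDiff_section τ).differentiable (by simp) (x, y)).hasFDerivAt
  rw [HasFDerivAt.fderiv (f := Function.uncurry
      fun x y : Fin n → ℝ => character m y * (τ : Phase n → ℂ) (x, y)) h1]
  simp [covX]

/-- The iterated derivatives of a Weil--Brezin coefficient are Weil--Brezin coefficients. -/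
theorem iteratedFDeriv_weilBrezin (m : Fin n → ℤ) (τ : lineSection n d) (x : Fin n → ℝ) {r : ℕ}
    (i : Fin r → Fin n) :
    iteratedFDeriv ℝ r (weilBrezin m τ) x (fun l => Pi.single (i l) 1) =
      weilBrezin m (iterateOperator covX i τ) x := by
  induction r generalizing τ x with
  | zero => simp [iterateOperator]
  | succ r ih =>
    obtain ⟨j, i, rfl⟩ : ∃ j i', i = Fin.cons j i' := ⟨i 0, Fin.tail i, by simp⟩
    have h1 : (fun l => (Pi.single ((Fin.cons j i : Fin (r + 1) → Fin n) l) 1 : Fin n → ℝ)) =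
        Fin.cons (Pi.single j 1) fun l => Pi.single (i l) 1 := by
      funext l
      refine Fin.cases ?_ (fun l => ?_) l <;> simp
    have h2 : (fun x => iteratedFDeriv ℝ r (weilBrezin m τ) x (fun l => Pi.single (i l) 1)) =
        weilBrezin m (iterateOperator covX i τ) := funext fun x => ih τ x i
    have h3 : DifferentiableAt ℝ (iteratedFDeriv ℝ r (weilBrezin m τ)) x :=
      ((contDiff_weilBrezin m τ).differentiable_iteratedFDeriv
        (by exact_mod_cast ENat.natCast_lt_top r)) x
    rw [h1, iteratedFDeriv_succ_apply_left, Fin.cons_zero, Fin.tail_cons, iterateOperator_cons,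
      Module.End.mul_apply, ← fderiv_weilBrezin, ← h2,
      fderiv_continuousMultilinear_apply_const_apply h3]

/-! ### Averaging along the leaves of the polarization -/

/-- The parallel transport of `τ` along `∂/∂yʲ` for time `t`. -/
def transport (j : Fin n) (τ : Phase n → ℂ) (d : ℤ) (z : Phase n) (t : ℝ) : ℂ :=
  Complex.exp (-(2 * Real.pi * Complex.I * d * z.1 j * t)) * τ (z.1, z.2 + t • Pi.single j 1)

theorem contDiff_transport (j : Fin n) (τ : lineSection n d) :
    ContDiff ℝ ∞ (Function.uncurry (transport j (τ : Phase n → ℂ) d)) := by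
  have h1 : ContDiff ℝ ∞ fun q : Phase n × ℝ => ((q.1.1 j : ℝ) : ℂ) :=
    Complex.ofRealCLM.contDiff.comp ((contDiff_apply ℝ ℝ j).comp (contDiff_fst.comp contDiff_fst))
  have h2 : ContDiff ℝ ∞ fun q : Phase n × ℝ => ((q.2 : ℝ) : ℂ) :=
    Complex.ofRealCLM.contDiff.comp contDiff_snd
  have h3 : ContDiff ℝ ∞ fun q : Phase n × ℝ =>
      ((q.1.1, q.1.2 + q.2 • Pi.single j 1) : Phase n) :=
    (contDiff_fst.comp contDiff_fst).prodMk ((contDiff_snd.comp contDiff_fst).add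
      (contDiff_snd.smul contDiff_const))
  exact (((contDiff_const.mul h1).mul h2).neg.cexp).mul ((contDiff_section τ).comp h3)

theorem contDiff_weighted_transport (j : Fin n) (τ : lineSection n d) {w : ℝ → ℂ}
    (hw : ContDiff ℝ ∞ w) : ContDiff ℝ ∞ (Function.uncurry
      fun (z : Phase n) (t : ℝ) => w t * transport j (τ : Phase n → ℂ) d z t) :=
  (hw.comp contDiff_snd).mul (contDiff_transport j τ)

/-- The phase depends on `x` only, which is fixed along the leaf, and its `t`-derivative supplies
exactly the connection term of `covY`. -/
theorem hasDerivAt_transport (j : Fin n) (τ : lineSection n d) (z : Phase n) (t : ℝ) :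
    HasDerivAt (transport j (τ : Phase n → ℂ) d z)
      (transport j ((covY j τ : lineSection n d) : Phase n → ℂ) d z t) t := by
  have h1 : HasDerivAt (fun t : ℝ => Complex.exp (-(2 * Real.pi * Complex.I * d * z.1 j * t)))
      (Complex.exp (-(2 * Real.pi * Complex.I * d * z.1 j * t)) *
        -(2 * Real.pi * Complex.I * d * z.1 j * 1)) t :=
    (((hasDerivAt_id t).ofReal_comp.const_mul _).neg).cexp
  have h2 : HasDerivAt (fun t : ℝ => ((z.1, z.2 + t • Pi.single j 1) : Phase n))
      (0, Pi.single j 1) t := by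
    refine (hasDerivAt_const t z.1).prodMk ?_
    simpa using ((hasDerivAt_id t).smul_const (Pi.single j 1 : Fin n → ℝ)).const_add z.2
  have h3 := (((contDiff_section τ).differentiable (by simp)) _).hasFDerivAt.comp_hasDerivAt t h2
  convert! h1.mul h3 using 1
  simp only [transport, covY, LinearMap.coe_mk, AddHom.coe_mk, Function.comp]
  ring

/-- The connection is flat along the leaves: the phase does not depend on `y`, so transport in
direction `j` commutes with `covY i` for every `i`. -/
theorem covY_transport (i j : Fin n) (τ : lineSection n d) (z : Phase n) (t : ℝ) :
    fderiv ℝ (Function.uncurry (transport j (τ : Phase n → ℂ) d)) (z, t) ((0, Pi.single i 1), 0) -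
      2 * Real.pi * Complex.I * d * z.1 i * transport j (τ : Phase n → ℂ) d z t =
      transport j ((covY i τ : lineSection n d) : Phase n → ℂ) d z t := by
  -- The directional derivative is computed twice along the line with parameter `s`, through the
  -- transport and through `τ` itself, and the two values are compared.
  have h0 : HasDerivAt (fun s : ℝ => ((z, t) : Phase n × ℝ) + s • ((0, Pi.single i 1), 0))
      ((0, Pi.single i 1), 0) 0 := by
    simpa using ((hasDerivAt_id (0 : ℝ)).smul_const
      (((0, Pi.single i 1), 0) : Phase n × ℝ)).const_add (z, t)
  have h1 := HasFDerivAt.comp_hasDerivAt (0 : ℝ) (by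
    simpa using ((contDiff_transport j τ).differentiable (by simp) (z, t)).hasFDerivAt) h0
  have h2 : HasDerivAt (fun s : ℝ => ((z.1, z.2 + t • Pi.single j 1 + s • Pi.single i 1) : Phase n))
      (0, Pi.single i 1) 0 := by
    refine (hasDerivAt_const _ z.1).prodMk ?_
    simpa using ((hasDerivAt_id (0 : ℝ)).smul_const (Pi.single i 1 : Fin n → ℝ)).const_add
      (z.2 + t • Pi.single j 1)
  have h3 := (HasFDerivAt.comp_hasDerivAt (0 : ℝ) (by
    simpa using (((contDiff_section τ).differentiable (by simp))
      (z.1, z.2 + t • Pi.single j 1)).hasFDerivAt) h2).const_mul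
    (Complex.exp (-(2 * Real.pi * Complex.I * d * z.1 j * t)))
  have h4 := h1.unique (h3.congr_of_eventuallyEq (Filter.Eventually.of_forall fun s => by
    simp only [Function.comp, Function.uncurry, transport, Prod.smul_mk, Prod.fst_add,
      Prod.snd_add, smul_zero, add_zero]
    rw [add_right_comm]))
  rw [h4]
  simp only [transport, covY, LinearMap.coe_mk, AddHom.coe_mk]
  ring

/-- Shifting `x` by `μ` changes the phase by `e^{-2πi d μ_j t}`, which cancels the change of the
factor of automorphy between `y` and `y + t e_j`. -/
theorem transport_translate (j : Fin n) (τ : lineSection n d) (μ ν : Fin n → ℤ) (x y : Fin n → ℝ)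
    (t : ℝ) : transport j (τ : Phase n → ℂ) d (x + intVec μ, y + intVec ν) t =
      character (d • μ) y * transport j (τ : Phase n → ℂ) d (x, y) t := by
  have h1 := section_translate τ μ ν (x, y + t • Pi.single j 1)
  simp only [Prod.mk_add_mk] at h1
  have h2 : y + intVec ν + t • (Pi.single j 1 : Fin n → ℝ) =
      y + t • Pi.single j 1 + intVec ν := by abel
  have h3 : character (d • μ) (y + t • Pi.single j 1) =
      character (d • μ) y * Complex.exp (2 * Real.pi * Complex.I * d * μ j * t) := by
    unfold character
    rw [← Complex.exp_add]
    congr 1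
    have : ∑ i, ((d • μ) i : ℂ) * (((y + t • Pi.single j 1 : Fin n → ℝ) i : ℝ) : ℂ) =
        ∑ i, ((d • μ) i : ℂ) * (y i : ℂ) + d * μ j * t := by
      simp only [Pi.add_apply, Complex.ofReal_add, mul_add, Finset.sum_add_distrib]
      congr 1
      rw [Finset.sum_eq_single j]
      · simp
      · intro b _ hb
        simp [hb]
      · simp
    rw [this]
    ring
  have h4 : Complex.exp (-(2 * Real.pi * Complex.I * d * ((x j + μ j : ℝ) : ℂ) * t)) *
      Complex.exp (2 * Real.pi * Complex.I * d * μ j * t) =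
      Complex.exp (-(2 * Real.pi * Complex.I * d * x j * t)) := by
    rw [← Complex.exp_add]
    congr 1
    push_cast
    ring
  simp only [transport, h2, h1, h3, Pi.add_apply, intVec]
  rw [← h4]
  ring

/-- The average of the parallel transports of `τ` along `∂/∂yʲ`, with weight `w`. -/
def leafAverage (w : ℝ → ℂ) (hw : ContDiff ℝ ∞ w) (j : Fin n) (τ : lineSection n d) :
    lineSection n d :=
  ⟨fun z => ∫ t in Set.Icc (0 : ℝ) 1, w t * transport j (τ : Phase n → ℂ) d z t,
    contDiff_setIntegral_param (contDiff_weighted_transport j τ hw) isCompact_Icc, by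
    intro μ ν x y
    simp only [transport_translate, ← integral_const_mul]
    congr 1
    funext t
    ring⟩

theorem leafAverage_apply {w : ℝ → ℂ} (hw : ContDiff ℝ ∞ w) (j : Fin n) (τ : lineSection n d)
    (z : Phase n) : (leafAverage w hw j τ : Phase n → ℂ) z =
      ∫ t in Set.Icc (0 : ℝ) 1, w t * transport j (τ : Phase n → ℂ) d z t := rfl

theorem continuous_weighted_transport (j : Fin n) (τ : lineSection n d) {w : ℝ → ℂ}
    (hw : ContDiff ℝ ∞ w) (z : Phase n) : Continuous fun t =>
      w t * transport j (τ : Phase n → ℂ) d z t :=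
  (contDiff_weighted_transport j τ hw).continuous.comp (f := fun t => (z, t)) (by fun_prop)

theorem covY_leafAverage {w : ℝ → ℂ} (hw : ContDiff ℝ ∞ w) (i j : Fin n) (τ : lineSection n d) :
    covY i (leafAverage w hw j τ) = leafAverage w hw j (covY i τ) := by
  ext z
  have h1 : fderiv ℝ (fun z => ∫ t in Set.Icc (0 : ℝ) 1, w t * transport j (τ : Phase n → ℂ) d z t)
      z (0, Pi.single i 1) = _ :=
    fderiv_setIntegral_param (contDiff_weighted_transport j τ hw) isCompact_Icc z _
  have hd := (contDiff_weighted_transport j τ hw).continuous_fderiv (by simp)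
  have hc : Continuous fun t => fderiv ℝ (Function.uncurry
      fun (z : Phase n) (t : ℝ) => w t * transport j (τ : Phase n → ℂ) d z t) (z, t)
        ((0, Pi.single i 1), 0) :=
    (hd.clm_apply continuous_const).comp (f := fun t => (z, t)) (by fun_prop)
  change fderiv ℝ (fun z => ∫ t in Set.Icc (0 : ℝ) 1, w t * transport j (τ : Phase n → ℂ) d z t)
      z (0, Pi.single i 1) - 2 * Real.pi * Complex.I * d * z.1 i *
        ∫ t in Set.Icc (0 : ℝ) 1, w t * transport j (τ : Phase n → ℂ) d z t = _
  rw [h1, leafAverage_apply, ← integral_const_mul, ← integral_sub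
    (hc.continuousOn.integrableOn_compact isCompact_Icc)
    (((continuous_weighted_transport j τ hw z).continuousOn.integrableOn_compact
      isCompact_Icc).const_mul _)]
  congr 1
  funext t
  have h2 : HasFDerivAt (Function.uncurry
      fun (z : Phase n) (t : ℝ) => w t * transport j (τ : Phase n → ℂ) d z t) _ (z, t) :=
    ((hw.differentiable (by simp) t).hasFDerivAt.comp (z, t)
      (hasFDerivAt_snd (𝕜 := ℝ) (p := (z, t)))).mul
      ((contDiff_transport j τ).differentiable (by simp) (z, t)).hasFDerivAt
  rw [h2.fderiv, ← covY_transport]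
  simp
  ring

theorem transport_zero (j : Fin n) (τ : Phase n → ℂ) (z : Phase n) : transport j τ d z 0 = τ z := by
  simp [transport]

/-- The leaf closes up at `t = 1`, where the factor of automorphy is trivial because `μ = 0`. What
remains is the holonomy of the leaf. -/
theorem transport_one (j : Fin n) (τ : lineSection n d) (z : Phase n) :
    transport j (τ : Phase n → ℂ) d z 1 =
      Complex.exp (-(2 * Real.pi * Complex.I * d * z.1 j)) * (τ : Phase n → ℂ) z := by
  have h1 := section_translate τ 0 (Pi.single j 1) z
  have h2 : (intVec 0, intVec (Pi.single j 1)) = ((0, Pi.single j 1) : Phase n) := by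
    ext i
    · simp [intVec]
    · by_cases h : i = j
      · subst h
        simp [intVec]
      · simp [intVec, h]
  rw [h2] at h1
  have h3 : z + (0, Pi.single j 1) = (z.1, z.2 + Pi.single j 1) := by
    ext <;> simp
  rw [h3] at h1
  simp only [transport, one_smul, h1]
  simp [character]

/-- The integrand is the `t`-derivative of the transport, so the integral is the holonomy term at `t
= 1` minus the value at `t = 0`. -/
theorem covY_leafAverage_one (j : Fin n) (τ : lineSection n d) (z : Phase n) :
    ((covY j (leafAverage (fun _ => 1) contDiff_const j τ) : lineSection n d) : Phase n → ℂ) z =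
      (Complex.exp (-(2 * Real.pi * Complex.I * d * z.1 j)) - 1) * (τ : Phase n → ℂ) z := by
  rw [covY_leafAverage, leafAverage_apply, integral_Icc_eq_integral_Ioc,
    ← intervalIntegral.integral_of_le zero_le_one]
  have h1 := intervalIntegral.integral_eq_sub_of_hasDerivAt (a := 0) (b := 1)
    (f := transport j (τ : Phase n → ℂ) d z) (fun t _ => hasDerivAt_transport j τ z t)
    (by simpa using (continuous_weighted_transport j (covY j τ)
      (contDiff_const (c := 1)) z).intervalIntegrable 0 1)
  simp only [one_mul]
  rw [h1, transport_zero, transport_one]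
  ring

theorem contDiff_one_sub : ContDiff ℝ ∞ fun t : ℝ => 1 - (t : ℂ) :=
  contDiff_const.sub Complex.ofRealCLM.contDiff

/-- Integration by parts in `t`: the weight `1 - t` vanishes at `t = 1` and equals `1` at `t = 0`,
so `-τ` is the only boundary term. Hence averaging changes `τ` by a covariant derivative along the
leaf. -/
theorem covY_leafAverage_sub (j : Fin n) (τ : lineSection n d) :
    covY j (leafAverage (fun t => 1 - (t : ℂ)) contDiff_one_sub j τ) =
      leafAverage (fun _ => 1) contDiff_const j τ - τ := by
  ext z
  rw [covY_leafAverage]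
  change (leafAverage _ _ j (covY j τ) : Phase n → ℂ) z =
    (leafAverage (fun _ => 1) contDiff_const j τ : Phase n → ℂ) z - (τ : Phase n → ℂ) z
  rw [leafAverage_apply, leafAverage_apply, integral_Icc_eq_integral_Ioc,
    integral_Icc_eq_integral_Ioc, ← intervalIntegral.integral_of_le zero_le_one,
    ← intervalIntegral.integral_of_le zero_le_one]
  have hi1 := (continuous_weighted_transport j (covY j τ) contDiff_one_sub z).intervalIntegrable
    (μ := volume) 0 1
  have hi2 := (continuous_weighted_transport j τ (contDiff_const (c := 1)) z).intervalIntegrable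
    (μ := volume) 0 1
  have h1 := intervalIntegral.integral_eq_sub_of_hasDerivAt (a := 0) (b := 1)
    (f := fun t : ℝ => (1 - (t : ℂ)) * transport j (τ : Phase n → ℂ) d z t)
    (f' := fun t : ℝ => (1 - (t : ℂ)) * transport j ((covY j τ : lineSection n d) : Phase n → ℂ) d z t
      - 1 * transport j (τ : Phase n → ℂ) d z t)
    (fun t _ => by
      have h2 := ((hasDerivAt_id t).ofReal_comp.const_sub 1).mul (hasDerivAt_transport j τ z t)
      convert! h2 using 1
      simp
      ring) (hi1.sub hi2)
  rw [intervalIntegral.integral_sub hi1 hi2, transport_zero] at h1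
  have h3 : ∀ a b c : ℂ, a - b = c → a = b + c := fun a b c h => by rw [← h]; ring
  rw [h3 _ _ _ h1]
  simp
  ring

theorem polarized_covY (s : polarizedSection n d) (j : Fin n) (τ : lineSection n (-d)) :
    s.1.1 (covY j τ) = 0 := by
  have h1 := s.2
  simp only [polarizedSection, Submodule.mem_iInf, LinearMap.mem_ker] at h1
  have h2 : -(s.1.1 (covY j τ)) = 0 := congrArg (fun s : distSection n d => s.1 τ) (h1 j)
  simpa using h2

theorem polarized_leafAverage (s : polarizedSection n d) (j : Fin n) (τ : lineSection n (-d)) :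
    s.1.1 (leafAverage (fun _ => 1) contDiff_const j τ) = s.1.1 τ := by
  have h := polarized_covY s j (leafAverage (fun t => 1 - (t : ℂ)) contDiff_one_sub j τ)
  rw [covY_leafAverage_sub, map_sub] at h
  exact sub_eq_zero.1 h

/-- Test sections have degree `-d`, so the factor is the leaf holonomy minus one, and `σ` is the
covariant derivative of the average of `τ`. -/
theorem polarized_eq_zero_of_dvd (s : polarizedSection n d) (j : Fin n)
    {σ : lineSection n (-d)} (τ : lineSection n (-d))
    (h : ∀ z, (σ : Phase n → ℂ) z =
      (Complex.exp (2 * Real.pi * Complex.I * d * z.1 j) - 1) * (τ : Phase n → ℂ) z) :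
    s.1.1 σ = 0 := by
  rw [← polarized_covY s j (leafAverage (fun _ => 1) contDiff_const j τ)]
  congr 1
  ext z
  rw [h, covY_leafAverage_one]
  simp

/-! ### Division by functions of one variable -/

/-- Hadamard's lemma with parameters. -/
theorem exists_hadamard_quotient {E : Type} [NormedAddCommGroup E] [NormedSpace ℝ E]
    [LocallyCompactSpace E] {g : E → ℂ} (hg : ContDiff ℝ ∞ g) (l : E →L[ℝ] ℝ) (e : E) (a : ℝ) :
    ∃ q : E → ℂ, ContDiff ℝ ∞ q ∧
      (∀ z, g z = g (z + (a - l z) • e) + ((l z - a : ℝ) : ℂ) * q z) ∧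
      ∀ z, l z = a → q z = fderiv ℝ g z e := by
  have hF : ContDiff ℝ ∞ (Function.uncurry fun (z : E) (t : ℝ) =>
      fderiv ℝ g (z + ((t - 1) * (l z - a)) • e) e) := by
    refine ContDiff.clm_apply ((hg.fderiv_right (m := ∞) (by simp)).comp ?_) contDiff_const
    exact contDiff_fst.add (((contDiff_snd.sub contDiff_const).mul
      ((l.contDiff.comp contDiff_fst).sub contDiff_const)).smul contDiff_const)
  -- The quotient is the mean derivative over the segment from `z + (a - l z) • e` at `t = 0` to `z`
  -- at `t = 1`. The segment is a point when `l z = a`.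
  refine ⟨fun z => ∫ t in Set.Icc (0 : ℝ) 1, fderiv ℝ g (z + ((t - 1) * (l z - a)) • e) e,
    contDiff_setIntegral_param hF isCompact_Icc, fun z => ?_, fun z hz => ?_⟩
  · have hd : ∀ t : ℝ, HasDerivAt (fun t : ℝ => g (z + ((t - 1) * (l z - a)) • e))
        (((l z - a : ℝ) : ℂ) * fderiv ℝ g (z + ((t - 1) * (l z - a)) • e) e) t := by
      intro t
      have h1 : HasDerivAt (fun t : ℝ => z + ((t - 1) * (l z - a)) • e) ((l z - a) • e) t := by
        simpa using ((((hasDerivAt_id t).sub_const 1).mul_const (l z - a)).smul_const e).const_add z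
      have h2 := (hg.differentiable (by simp) _).hasFDerivAt.comp_hasDerivAt t h1
      exact h2.congr_deriv (by simp)
    have hc : Continuous fun t : ℝ => fderiv ℝ g (z + ((t - 1) * (l z - a)) • e) e :=
      hF.continuous.comp (f := fun t => (z, t)) (by fun_prop)
    have h := intervalIntegral.integral_eq_sub_of_hasDerivAt (a := 0) (b := 1)
      (fun t _ => hd t) ((continuous_const.mul hc).intervalIntegrable _ _)
    rw [intervalIntegral.integral_const_mul, intervalIntegral.integral_of_le zero_le_one,
      ← integral_Icc_eq_integral_Ioc] at h
    rw [h]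
    simp
  · simp [hz]

theorem exp_eq_one_iff_mul_intCast (k : ℕ+) (x : ℝ) :
    Complex.exp (2 * Real.pi * Complex.I * (k : ℕ) * x) = 1 ↔ ∃ m : ℤ, (k : ℝ) * x = m := by
  rw [Complex.exp_eq_one_iff]
  refine exists_congr fun m => ?_
  have h0 : (2 * Real.pi * Complex.I : ℂ) ≠ 0 := by simp [Real.pi_ne_zero]
  rw [show (2 * Real.pi * Complex.I * (k : ℕ) * x : ℂ) = (((k : ℝ) * x : ℝ) : ℂ) *
    (2 * Real.pi * Complex.I) by push_cast; ring, mul_left_inj' h0]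
  exact_mod_cast Iff.rfl

/-- The zeros of `e^{2πi k xʲ} - 1` in the variable `xʲ` are simple, so a smooth section vanishing
on them has a smooth quotient. -/
theorem exists_div_exp_sub_one (k : ℕ+) (j : Fin n) (σ : lineSection n d)
    (h : ∀ z : Phase n, (∃ m : ℤ, (k : ℝ) * z.1 j = m) → (σ : Phase n → ℂ) z = 0) :
    ∃ τ : lineSection n d, ∀ z, (σ : Phase n → ℂ) z =
      (Complex.exp (2 * Real.pi * Complex.I * (k : ℕ) * z.1 j) - 1) * (τ : Phase n → ℂ) z := by
  classical
  have hk : (0 : ℝ) < (k : ℝ) := by exact_mod_cast k.pos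
  let l : Phase n →L[ℝ] ℝ := (ContinuousLinearMap.proj j).comp (ContinuousLinearMap.fst ℝ _ _)
  let e : Phase n := (Pi.single j 1, 0)
  let g : Phase n → ℂ := fun z => Complex.exp (2 * Real.pi * Complex.I * (k : ℕ) * z.1 j) - 1
  have hl : ∀ z : Phase n, l z = z.1 j := fun z => rfl
  have hgd : ∀ z : Phase n, HasFDerivAt g ((2 * Real.pi * Complex.I * (k : ℕ) *
      Complex.exp (2 * Real.pi * Complex.I * (k : ℕ) * z.1 j)) •
        (Complex.ofRealCLM.comp l)) z := by
    intro z
    have h1 := (((Complex.ofRealCLM.comp l).hasFDerivAt (x := z)).const_mul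
      (2 * Real.pi * Complex.I * (k : ℕ))).cexp.sub_const 1
    refine h1.congr_fderiv ?_
    rw [smul_smul]
    simp [hl, mul_comm]
  have hg : ContDiff ℝ ∞ g :=
    (contDiff_const.mul (Complex.ofRealCLM.comp l).contDiff).cexp.sub contDiff_const
  have hg0 : ∀ z, g z = 0 ↔ ∃ m : ℤ, (k : ℝ) * z.1 j = m := fun z => by
    rw [← exp_eq_one_iff_mul_intCast, sub_eq_zero]
  let c : ℂ := 2 * Real.pi * Complex.I * (k : ℕ)
  have hc : c ≠ 0 := by simp [c, Real.pi_ne_zero]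
  -- On the zero set the value is the one given by l'Hôpital's rule, `c` being the derivative of `g`
  -- along `e` there.
  let u : Phase n → ℂ := fun z =>
    if g z = 0 then fderiv ℝ (σ : Phase n → ℂ) z e / c else (σ : Phase n → ℂ) z / g z
  have hu : ContDiff ℝ ∞ u := by
    rw [contDiff_iff_contDiffAt]
    intro z₀
    by_cases hz : g z₀ = 0
    · obtain ⟨m, hm⟩ := (hg0 z₀).1 hz
      obtain ⟨q, hq, hq1, hq2⟩ := exists_hadamard_quotient (contDiff_section σ) l e (z₀.1 j)
      obtain ⟨p, hp, hp1, hp2⟩ := exists_hadamard_quotient hg l e (z₀.1 j)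
      have hbase : ∀ z : Phase n, (z + (z₀.1 j - l z) • e).1 j = z₀.1 j := by
        intro z
        simp [e, hl]
      have hpa : ∀ z : Phase n, l z = z₀.1 j → p z = c := by
        intro z hz'
        rw [hp2 z hz', (hgd z).fderiv]
        have : Complex.exp (2 * Real.pi * Complex.I * (k : ℕ) * z.1 j) = 1 := by
          rw [← hl, hz']
          exact sub_eq_zero.1 hz
        simp [this, hl, e, c]
      -- Near a zero both `σ` and `g` are `l z - z₀.1 j` times a Hadamard quotient, and `p` equals
      -- `c ≠ 0` on the hyperplane. Within distance `1/k` there is no other zero hyperplane.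
      have hev : u =ᶠ[nhds z₀] fun z => q z / p z := by
        have ho : ∀ᶠ z in nhds z₀, |l z - z₀.1 j| < 1 / k := by
          have : Continuous fun z => |l z - z₀.1 j| := by fun_prop
          refine this.continuousAt.eventually_lt continuousAt_const ?_
          simp [hl]
        filter_upwards [ho] with z hz'
        by_cases hza : l z = z₀.1 j
        · have : g z = 0 := (hg0 z).2 ⟨m, by rw [← hl, hza, hm]⟩
          simp only [u, this, if_true, hpa z hza, hq2 z hza]
        · have hgz : g z ≠ 0 := by
            intro h0
            obtain ⟨m', hm'⟩ := (hg0 z).1 h0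
            have h2 : (l z - z₀.1 j) * (k : ℝ) = ((m' - m : ℤ) : ℝ) := by
              push_cast
              rw [← hm, ← hm', hl]
              ring
            rw [lt_div_iff₀ hk] at hz'
            have h3 : |l z - z₀.1 j| * (k : ℝ) = |(l z - z₀.1 j) * (k : ℝ)| := by
              rw [abs_mul, abs_of_pos hk]
            rw [h3, h2] at hz'
            have h1 : m' = m := by
              have : |m' - m| < 1 := by exact_mod_cast hz'
              have := Int.abs_lt_one_iff.1 this
              omega
            rw [h1, ← hm] at hm'
            exact hza (mul_left_cancel₀ hk.ne' hm')
          have h1 := hq1 z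
          have h2 := hp1 z
          rw [h (z + (z₀.1 j - l z) • e) ⟨m, by rw [hbase, hm]⟩, zero_add] at h1
          rw [(hg0 (z + (z₀.1 j - l z) • e)).2 ⟨m, by rw [hbase, hm]⟩, zero_add] at h2
          simp only [u, if_neg hgz]
          rw [h2] at hgz ⊢
          rw [h1, mul_div_mul_left _ _ (left_ne_zero_of_mul hgz)]
      refine ContDiffAt.congr_of_eventuallyEq ?_ hev
      simp only [div_eq_mul_inv]
      exact hq.contDiffAt.mul (hp.contDiffAt.inv (by rw [hpa z₀ rfl]; exact hc))
    · have hev : u =ᶠ[nhds z₀] fun z => (σ : Phase n → ℂ) z / g z := by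
        filter_upwards [hg.continuous.continuousAt.eventually_ne hz] with z hz'
        simp [u, hz']
      refine ContDiffAt.congr_of_eventuallyEq ?_ hev
      simp only [div_eq_mul_inv]
      exact (contDiff_section σ).contDiffAt.mul (hg.contDiffAt.inv hz)
  refine ⟨⟨u, hu, fun μ ν x y => ?_⟩, fun z => ?_⟩
  · have h1 : g (x + intVec μ, y + intVec ν) = g (x, y) := by
      have : Complex.exp (2 * Real.pi * Complex.I * (k : ℕ) * ((x j + μ j : ℝ) : ℂ)) =
          Complex.exp (2 * Real.pi * Complex.I * (k : ℕ) * (x j : ℂ)) := by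
        rw [Complex.exp_eq_exp_iff_exists_int]
        refine ⟨(k : ℕ) * μ j, ?_⟩
        push_cast
        ring
      simp only [g, Pi.add_apply, intVec, this]
    have h2 := section_translate σ μ ν (x, y)
    have h3 := fderiv_translate σ μ ν (x, y) e
    simp only [Prod.mk_add_mk] at h2 h3
    simp only [u, h1, h2, h3]
    -- On the zero set the derivative of the factor of automorphy drops out, because `e` has no `y`
    -- component.
    split_ifs
    · simp [e]
      ring
    · ring
  · change _ = g z * u z
    by_cases hz : g z = 0
    · rw [hz, zero_mul, h z ((hg0 z).1 hz)]
    · simp only [u, if_neg hz]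
      field_simp

theorem polarized_eq_zero_of_vanish (k : ℕ+) (s : polarizedSection n (k : ℕ)) (j : Fin n)
    (σ : lineSection n (-((k : ℕ) : ℤ)))
    (h : ∀ z : Phase n, (∃ m : ℤ, (k : ℝ) * z.1 j = m) → (σ : Phase n → ℂ) z = 0) :
    s.1.1 σ = 0 := by
  obtain ⟨τ, hτ⟩ := exists_div_exp_sub_one k j σ h
  exact polarized_eq_zero_of_dvd s j τ fun z => by rw [hτ]; push_cast; rfl

/-! ### Localization at the Bohr--Sommerfeld fibres -/

theorem round_eq_of_abs_sub_lt {t : ℝ} {m : ℤ} (h : |t - m| < 1 / 2) : round t = m := by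
  have h1 := round_le t m
  have h2 : |((round t - m : ℤ) : ℝ)| < 1 := by
    have : ((round t - m : ℤ) : ℝ) = (t - m) - (t - round t) := by push_cast; ring
    rw [this]
    exact (abs_sub _ _).trans_lt (by linarith)
  have h3 : |round t - m| < 1 := by exact_mod_cast h2
  have := Int.abs_lt_one_iff.1 h3
  omega

/-- A cutoff function near the integers. -/
def integerBump : ContDiffBump (0 : ℝ) := ⟨1 / 4, 1 / 3, by norm_num, by norm_num⟩

/-- The section which near `xʲ ∈ (1/k)ℤ` interpolates the restriction of `σ` to `xʲ ∈ (1/k)ℤ`. -/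
def localize (k : ℕ+) (j : Fin n) (σ : lineSection n d) : lineSection n d :=
  ⟨fun z => ((integerBump ((k : ℝ) * z.1 j - round ((k : ℝ) * z.1 j)) : ℝ) : ℂ) *
      (σ : Phase n → ℂ) (Function.update z.1 j (round ((k : ℝ) * z.1 j) / k), z.2), by
    have hk : (0 : ℝ) < (k : ℝ) := by exact_mod_cast k.pos
    constructor
    · rw [contDiff_iff_contDiffAt]
      intro z₀
      -- Away from half-integers the rounding is locally constant. At a half-integer it jumps, but
      -- there the cutoff vanishes identically nearby.
      by_cases hz : |(k : ℝ) * z₀.1 j - round ((k : ℝ) * z₀.1 j)| < 1 / 2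
      · have ho : ∀ᶠ z : Phase n in nhds z₀,
            |(k : ℝ) * z.1 j - round ((k : ℝ) * z₀.1 j)| < 1 / 2 := by
          have : Continuous fun z : Phase n =>
            |(k : ℝ) * z.1 j - round ((k : ℝ) * z₀.1 j)| := by fun_prop
          exact this.continuousAt.eventually_lt continuousAt_const hz
        refine ContDiffAt.congr_of_eventuallyEq (f := fun z : Phase n =>
          ((integerBump ((k : ℝ) * z.1 j - round ((k : ℝ) * z₀.1 j)) : ℝ) : ℂ) *
          (σ : Phase n → ℂ) (Function.update z.1 j (round ((k : ℝ) * z₀.1 j) / k), z.2)) ?_ ?_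
        · refine ContDiff.contDiffAt (ContDiff.mul ?_ ?_)
          · exact Complex.ofRealCLM.contDiff.comp (integerBump.contDiff.comp
              ((contDiff_const.mul ((contDiff_apply ℝ ℝ j).comp contDiff_fst)).sub contDiff_const))
          · refine (contDiff_section σ).comp (ContDiff.prodMk ?_ contDiff_snd)
            rw [contDiff_pi]
            intro i
            by_cases hi : i = j
            · subst hi
              simpa using contDiff_const
            · simp only [Function.update_of_ne hi]
              exact (contDiff_apply ℝ ℝ i).comp contDiff_fst
        · filter_upwards [ho] with z hz'
          rw [round_eq_of_abs_sub_lt hz']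
      -- The radius `1/6 = 1/2 - 1/3` keeps `k xʲ` at distance at least `1/3`, the outer radius of
      -- the cutoff, from every integer.
      · have ho : ∀ᶠ z : Phase n in nhds z₀, |(k : ℝ) * z.1 j - (k : ℝ) * z₀.1 j| < 1 / 6 := by
          have : Continuous fun z : Phase n => |(k : ℝ) * z.1 j - (k : ℝ) * z₀.1 j| := by fun_prop
          exact this.continuousAt.eventually_lt continuousAt_const (by simp)
        refine ContDiffAt.congr_of_eventuallyEq (contDiffAt_const (c := 0)) ?_
        filter_upwards [ho] with z hz'
        have h1 := round_le ((k : ℝ) * z₀.1 j) (round ((k : ℝ) * z.1 j))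
        have h2 := abs_sub_le ((k : ℝ) * z₀.1 j) ((k : ℝ) * z.1 j) (round ((k : ℝ) * z.1 j))
        rw [abs_sub_comm] at hz'
        rw [integerBump.zero_of_le_dist]
        · simp
        · rw [Real.dist_eq, sub_zero]
          change (1 / 3 : ℝ) ≤ _
          linarith
    · intro μ ν x y
      have h1 : (k : ℝ) * (x + intVec μ) j = (k : ℝ) * x j + (((k : ℕ) * μ j : ℤ) : ℝ) := by
        simp [intVec, mul_add]
      have h2 : Function.update (x + intVec μ) j
          (((round ((k : ℝ) * x j) + (k : ℕ) * μ j : ℤ) : ℝ) / k) =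
          Function.update x j (round ((k : ℝ) * x j) / k) + intVec μ := by
        funext i
        by_cases hi : i = j
        · subst hi
          simp [intVec, add_div]
        · simp [hi]
      have h3 := section_translate σ μ ν (Function.update x j (round ((k : ℝ) * x j) / k), y)
      simp only [Prod.mk_add_mk] at h3
      simp only [h1, round_add_intCast, h2, h3]
      push_cast
      rw [add_sub_add_right_eq_sub]
      ring⟩

theorem localize_of_mem (k : ℕ+) (j : Fin n) (σ : lineSection n d) (z : Phase n)
    (h : ∃ m : ℤ, (k : ℝ) * z.1 j = m) :
    (localize k j σ : Phase n → ℂ) z = (σ : Phase n → ℂ) z := by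
  obtain ⟨m, hm⟩ := h
  have hk : (k : ℝ) ≠ 0 := by exact_mod_cast k.ne_zero
  have h1 : (m : ℝ) / k = z.1 j := by rw [← hm]; field_simp
  have h2 : integerBump (0 : ℝ) = 1 := integerBump.one_of_mem_closedBall (by
    simp [integerBump.rIn_pos.le])
  change ((integerBump ((k : ℝ) * z.1 j - round ((k : ℝ) * z.1 j)) : ℝ) : ℂ) *
      (σ : Phase n → ℂ) (Function.update z.1 j (round ((k : ℝ) * z.1 j) / k), z.2) = _
  rw [hm, round_intCast, sub_self, h2, h1]
  simp

/-- Induction on the number of directions. `localize` carries the restriction of `σ` to `k xʲ ∈ ℤ`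
over to a section that vanishes already under the conditions for the remaining directions. The
difference vanishes where `k xʲ ∈ ℤ`, hence is annihilated. -/
theorem polarized_eq_zero_of_vanish_on (k : ℕ+) (s : polarizedSection n (k : ℕ))
    (S : Finset (Fin n)) (σ : lineSection n (-((k : ℕ) : ℤ)))
    (h : ∀ z : Phase n, (∀ j ∈ S, ∃ m : ℤ, (k : ℝ) * z.1 j = m) → (σ : Phase n → ℂ) z = 0) :
    s.1.1 σ = 0 := by
  induction S using Finset.induction_on generalizing σ with
  | empty =>
    have : σ = 0 := by
      ext z
      exact h z (by simp)
    simp [this]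
  | insert j S hj ih =>
    have hk : (k : ℝ) ≠ 0 := by exact_mod_cast k.ne_zero
    have h1 : s.1.1 (localize k j σ) = 0 := by
      refine ih _ fun z hz => ?_
      -- `localize` evaluates `σ` at the point whose `j`-th coordinate is rounded to `(1/k)ℤ`, so
      -- the condition for `j` comes for free.
      refine mul_eq_zero_of_right _ (h _ fun i hi => ?_)
      by_cases hij : i = j
      · subst hij
        exact ⟨round ((k : ℝ) * z.1 i), by simp; field_simp⟩
      · have := hz i (Finset.mem_of_mem_insert_of_ne hi hij)
        simpa [hij] using this
    have h2 : s.1.1 (σ - localize k j σ) = 0 := by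
      refine polarized_eq_zero_of_vanish k s j _ fun z hz => ?_
      change (σ : Phase n → ℂ) z - (localize k j σ : Phase n → ℂ) z = 0
      rw [localize_of_mem k j σ z hz, sub_self]
    rw [map_sub, h1, sub_zero] at h2
    exact h2

/-! ### Polarized sections are combinations of the `σ_k^{[m]}` -/

/-- Averaging over one leaf direction after another leaves all pairings with polarized sections
unchanged. The derivative of the average is holonomy minus one times the section, and the holonomy
is trivial on Bohr–Sommerfeld fibres. -/
theorem exists_vertically_constant (k : ℕ+) (τ : lineSection n (-((k : ℕ) : ℤ)))
    (S : Finset (Fin n)) : ∃ σ : lineSection n (-((k : ℕ) : ℤ)),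
      (∀ s : polarizedSection n (k : ℕ), s.1.1 σ = s.1.1 τ) ∧
      ∀ j ∈ S, ∀ (m : Fin n → ℤ) (y : Fin n → ℝ),
        ((covY j σ : lineSection n (-((k : ℕ) : ℤ))) : Phase n → ℂ) (modePoint k m, y) = 0 := by
  induction S using Finset.induction_on with
  | empty => exact ⟨τ, fun s => rfl, by simp⟩
  | insert j S _ ih =>
    obtain ⟨σ, h1, h2⟩ := ih
    refine ⟨leafAverage (fun _ => 1) contDiff_const j σ,
      fun s => (polarized_leafAverage s j σ).trans (h1 s), fun i hi m y => ?_⟩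
    rcases Finset.mem_insert.1 hi with rfl | hi
    · rw [covY_leafAverage_one]
      have h3 := (exp_eq_one_iff_mul_intCast k (modePoint k m i)).2 ⟨m i, by
        have hk : (k : ℝ) ≠ 0 := by exact_mod_cast k.ne_zero
        simp only [modePoint]
        field_simp⟩
      have h4 : -(2 * Real.pi * Complex.I * ((-((k : ℕ) : ℤ) : ℤ) : ℂ) * (modePoint k m i : ℂ)) =
          2 * Real.pi * Complex.I * (k : ℕ) * (modePoint k m i : ℂ) := by
        push_cast
        ring
      simp only [h4, h3, sub_self, zero_mul]
    -- Directions treated before are not spoiled: `covY i` commutes with the average, and transport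
    -- stays in the fibre over the same `x`.
    · rw [covY_leafAverage, leafAverage_apply]
      simp [transport, h2 i hi]

theorem modePoint_translate (k : ℕ+) (m q : Fin n → ℤ) :
    modePoint k (m + ((k : ℕ) : ℤ) • q) = modePoint k m + intVec q := by
  have hk : (k : ℝ) ≠ 0 := by exact_mod_cast k.ne_zero
  funext i
  simp [modePoint, intVec]
  field_simp

theorem character_add (m m' : Fin n → ℤ) (y : Fin n → ℝ) :
    character (m + m') y = character m y * character m' y := by
  unfold character
  rw [← Complex.exp_add]
  congr 1
  simp [add_mul, Finset.sum_add_distrib, mul_add]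

/-- The extra character `k q` cancels the factor of automorphy of degree `-k`. So the value at `m/k`
depends only on the class of `m` modulo `k`. -/
theorem weilBrezin_translate (k : ℕ+) (m q : Fin n → ℤ) (τ : lineSection n (-((k : ℕ) : ℤ)))
    (x : Fin n → ℝ) :
    weilBrezin (m + ((k : ℕ) : ℤ) • q) τ (x + intVec q) = weilBrezin m τ x := by
  unfold weilBrezin
  congr 1
  funext y
  have h1 := section_translate τ q 0 (x, y)
  have h2 : y + intVec (0 : Fin n → ℤ) = y := by
    funext i
    simp [intVec]
  have h3 : character (((k : ℕ) : ℤ) • q) y * character (-((k : ℕ) : ℤ) • q) y = 1 := by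
    rw [← character_add, neg_smul, add_neg_cancel]
    simp [character]
  simp only [Prod.mk_add_mk, h2] at h1
  rw [h1, character_add]
  linear_combination (character m y * (τ : Phase n → ℂ) (x, y)) * h3

theorem volume_real_cube : volume.real (cube n) = 1 := by
  rw [Measure.real, cube, Real.volume_Icc_pi]
  simp

/-- The last term vanishes for `d = -k` and `x = m/k`. There, covariantly constant sections are
multiples of the inverse character. -/
theorem fderiv_character_mul (m : Fin n → ℤ) (τ : lineSection n d) (x y : Fin n → ℝ) (j : Fin n) :
    fderiv ℝ (fun y => character m y * (τ : Phase n → ℂ) (x, y)) y (Pi.single j 1) =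
      character m y * ((covY j τ : lineSection n d) : Phase n → ℂ) (x, y) +
      2 * Real.pi * Complex.I * (m j + d * x j) *
        (character m y * (τ : Phase n → ℂ) (x, y)) := by
  obtain ⟨D, hD, hv⟩ := hasFDerivAt_character m y
  have hd : Differentiable ℝ (τ : Phase n → ℂ) := (contDiff_section τ).differentiable (by simp)
  have h1 : HasFDerivAt (fun y => (τ : Phase n → ℂ) (x, y))
      ((fderiv ℝ (τ : Phase n → ℂ) (x, y)).comp
        ((0 : (Fin n → ℝ) →L[ℝ] (Fin n → ℝ)).prod (ContinuousLinearMap.id ℝ _))) y :=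
    (hd (x, y)).hasFDerivAt.comp y ((hasFDerivAt_const x y).prodMk (hasFDerivAt_id y))
  have h2 : HasFDerivAt (fun y => character m y * (τ : Phase n → ℂ) (x, y)) _ y := hD.mul h1
  rw [h2.fderiv]
  have h3 : ∑ i, ((m i : ℤ) : ℂ) * (((Pi.single j 1 : Fin n → ℝ) i : ℝ) : ℂ) = m j := by
    rw [Finset.sum_eq_single j]
    · simp
    · intro b _ hb
      simp [hb]
    · simp
  simp [hv, h3, covY]
  ring

/-- After averaging, the section times the character is constant on each Bohr–Sommerfeld fibre. The
constant is the Weil–Brezin coefficient, which is zero, so the section vanishes on all these fibres.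
-/
theorem polarized_eq_zero_of_sigma (k : ℕ+) (s : polarizedSection n (k : ℕ))
    (τ : lineSection n (-((k : ℕ) : ℤ)))
    (h : ∀ m : Fin n → ℤ, weilBrezin m τ (modePoint k m) = 0) : s.1.1 τ = 0 := by
  have hk : (k : ℝ) ≠ 0 := by exact_mod_cast k.ne_zero
  have hkc : ((k : ℕ) : ℂ) ≠ 0 := by exact_mod_cast k.ne_zero
  obtain ⟨σ, h1, h2⟩ := exists_vertically_constant k τ Finset.univ
  rw [← h1]
  have h3 : ∀ (m : Fin n → ℤ) (y : Fin n → ℝ), (σ : Phase n → ℂ) (modePoint k m, y) = 0 := by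
    intro m y
    have hd : Differentiable ℝ fun y => character m y * (σ : Phase n → ℂ) (modePoint k m, y) :=
      ((contDiff_character m).mul ((contDiff_section σ).comp
        (contDiff_const.prodMk contDiff_id))).differentiable (by simp)
    have h4 : ∀ y, fderiv ℝ (fun y => character m y * (σ : Phase n → ℂ) (modePoint k m, y)) y
        = 0 := by
      intro y
      ext v
      have hv : v = ∑ j, v j • (Pi.single j 1 : Fin n → ℝ) := pi_eq_sum_univ' v
      rw [hv, map_sum]
      refine Finset.sum_eq_zero fun j _ => ?_
      have h0 : (m j : ℂ) + ((-((k : ℕ) : ℤ) : ℤ) : ℂ) * ((modePoint k m j : ℝ) : ℂ) = 0 := by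
        simp only [modePoint]
        push_cast
        field_simp
        ring
      rw [map_smul, fderiv_character_mul, h2 j (Finset.mem_univ j), h0]
      simp
    have h5 := is_const_of_fderiv_eq_zero hd h4
    -- The coefficient survives the averaging because `sigma k m` is itself polarized.
    have h6 : weilBrezin m σ (modePoint k m) = 0 := (h1 (sigma k m)).trans (h m)
    unfold weilBrezin at h6
    simp only [h5 _ y] at h6
    rw [setIntegral_const, volume_real_cube, one_smul] at h6
    refine (mul_eq_zero.1 h6).resolve_left ?_
    exact fun h0 => by simpa [h0] using norm_character m y
  refine polarized_eq_zero_of_vanish_on k s Finset.univ σ fun z hz => ?_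
  choose m hm using fun j => hz j (Finset.mem_univ j)
  have h4 : z.1 = modePoint k m := by
    funext j
    simp only [modePoint, ← hm]
    field_simp
  have := h3 m z.2
  rwa [← h4] at this

/-- Subtracting from `τ` its expansion in the dual test sections leaves a section with zero
coefficients at all `m/k`, which every polarized section annihilates. So `s` is determined by its
values on the dual test sections. -/
theorem exists_eq_combination (k : ℕ+) (s : polarizedSection n (k : ℕ)) :
    ∃ c, s = combination n k c := by
  choose δ hδ using exists_dual_testSection (n := n) k
  refine ⟨fun m => s.1.1 (δ m), Subtype.ext (Subtype.ext (LinearMap.ext fun τ => ?_))⟩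
  rw [combination_apply]
  let σ := τ - ∑ m : Fin n → Fin k, (sigma k fun i => ((m i : ℕ) : ℤ)).1.1 τ • δ m
  have h1 : ∀ m : Fin n → Fin k, (sigma k fun i => ((m i : ℕ) : ℤ)).1.1 σ = 0 := by
    intro m
    simp [σ, hδ]
  have h2 : s.1.1 σ = 0 := by
    refine polarized_eq_zero_of_sigma k s σ fun m => ?_
    have hk : (0 : ℤ) < ((k : ℕ) : ℤ) := by exact_mod_cast k.pos
    -- Duality controls only representatives in `{0, …, k-1}ⁿ`; other modes are reduced modulo `k`
    -- to their residue `r`.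
    let r : Fin n → Fin k := fun i => ⟨(m i % ((k : ℕ) : ℤ)).toNat, by
      have := Int.emod_lt_of_pos (m i) hk
      have := Int.emod_nonneg (m i) hk.ne'
      omega⟩
    have h3 : m = (fun i => ((r i : ℕ) : ℤ)) + ((k : ℕ) : ℤ) • fun i => m i / ((k : ℕ) : ℤ) := by
      funext i
      have := Int.emod_nonneg (m i) hk.ne'
      have h4 := Int.emod_add_mul_ediv (m i) ((k : ℕ) : ℤ)
      simp only [Pi.add_apply, Pi.smul_apply, smul_eq_mul, r, Int.toNat_of_nonneg this, h4]
    rw [h3, modePoint_translate, weilBrezin_translate]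
    exact h1 r
  simp only [σ, map_sub, map_sum, map_smul, smul_eq_mul] at h2
  rw [sub_eq_zero.1 h2]
  exact Finset.sum_congr rfl fun m _ => mul_comm _ _

/-! ### Fibrewise Fourier series -/

theorem mFourier_coe (p : Fin n → ℤ) (y : Fin n → ℝ) :
    UnitAddTorus.mFourier p (fun i => (y i : UnitAddCircle)) = character p y := by
  simp only [UnitAddTorus.mFourier, ContinuousMap.coe_mk, fourier_coe_apply, character,
    ← Complex.exp_sum, Finset.mul_sum]
  congr 1
  refine Finset.sum_congr rfl fun i _ => ?_
  push_cast
  ring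

/-- A periodic continuous function descends to the torus, where summability of the Fourier
coefficients gives pointwise convergence. -/
theorem hasSum_fourier_of_periodic {g : (Fin n → ℝ) → ℂ} (hg : Continuous g)
    (hper : ∀ (ν : Fin n → ℤ) y, g (y + intVec ν) = g y)
    (hs : Summable fun p => ∫ y in cube n, character (-p) y * g y) (y : Fin n → ℝ) :
    HasSum (fun p => (∫ y in cube n, character (-p) y * g y) * character p y) (g y) := by
  let π : C(Fin n → ℝ, UnitAddTorus (Fin n)) := ⟨fun y i => (y i : UnitAddCircle), by fun_prop⟩
  have hπ : Topology.IsQuotientMap π :=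
    (IsOpenQuotientMap.piMap fun _ : Fin n =>
      (QuotientAddGroup.isOpenQuotientMap_mk (N := AddSubgroup.zmultiples (1 : ℝ)))).isQuotientMap
  have hfac : Function.FactorsThrough (⟨g, hg⟩ : C(Fin n → ℝ, ℂ)) π := by
    intro a b hab
    have h : ∀ i, ∃ ν : ℤ, b i = a i + ν := by
      intro i
      obtain ⟨ν, hν⟩ := AddSubgroup.mem_zmultiples_iff.1 (QuotientAddGroup.eq.1 (congrFun hab i))
      exact ⟨ν, by simp at hν; linarith⟩
    choose ν hν using h
    change g a = g b
    rw [← hper ν a]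
    congr 1
    funext i
    exact (hν i).symm
  let G : C(UnitAddTorus (Fin n), ℂ) := hπ.lift ⟨g, hg⟩ hfac
  have hG : ∀ y : Fin n → ℝ, G (fun i => (y i : UnitAddCircle)) = g y := fun y =>
    congrArg (fun f : C(Fin n → ℝ, ℂ) => f y) (hπ.lift_comp ⟨g, hg⟩ hfac)
  have hc : ∀ p, UnitAddTorus.mFourierCoeff G p = ∫ y in cube n, character (-p) y * g y := by
    intro p
    rw [UnitAddTorus.mFourierCoeff_eq_integral G p 0]
    simp only [mFourier_coe, hG, smul_eq_mul]
    -- The torus integral is taken over a half-open box, which differs from the closed cube by a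
    -- null set.
    refine setIntegral_congr_set ?_
    have h := Measure.univ_pi_Ioc_ae_eq_Icc (μ := fun _ : Fin n => (volume : Measure ℝ))
      (f := 0) (g := 1)
    have h1 : {y : Fin n → ℝ | ∀ i, y i ∈ Set.Ioc ((0 : Fin n → ℝ) i) ((0 : Fin n → ℝ) i + 1)} =
        Set.univ.pi fun i => Set.Ioc ((0 : Fin n → ℝ) i) ((1 : Fin n → ℝ) i) := by
      ext y
      simp
    rw [h1]
    exact h
  have := UnitAddTorus.hasSum_mFourier_series_apply_of_summable (f := G)
    (hs.congr fun p => (hc p).symm) (fun i => (y i : UnitAddCircle))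
  simpa only [hc, mFourier_coe, hG, smul_eq_mul] using this

theorem intVec_zero : intVec (0 : Fin n → ℤ) = 0 := by
  funext i
  simp [intVec]

theorem hasSum_fibreFourier (g : TorusFunction n) (x y : Fin n → ℝ) :
    HasSum (fun p => fibreFourier g p x * character p y) ((g : Phase n → ℂ) (x, y)) := by
  refine hasSum_fourier_of_periodic (g := fun y => (g : Phase n → ℂ) (x, y))
    ((contDiff_section g).continuous.comp (by fun_prop)) (fun ν y => ?_)
    (summable_norm_fibreFourier g fun _ => x).of_norm y
  have h := section_translate g 0 ν (x, y)
  simp only [Prod.mk_add_mk, intVec_zero, add_zero] at h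
  rw [h]
  simp [character]

/-- Multiplying by the `p`-th character shifts the mode `m` to `m + p`. Integration term by term is
allowed because the `ĝ_p(x)` are absolutely summable and `τ` is bounded. -/
theorem hasSum_weilBrezin_mulFunction (g : TorusFunction n) (m : Fin n → ℤ) (τ : lineSection n d)
    (x : Fin n → ℝ) :
    HasSum (fun p => fibreFourier g p x * weilBrezin (m + p) τ x)
      (weilBrezin m (mulFunction g τ) x) := by
  obtain ⟨B, hB⟩ := exists_norm_section_le τ
  have h := hasSum_integral_of_summable_integral_norm (μ := volume.restrict (cube n))
    (F := fun (p : Fin n → ℤ) y =>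
      fibreFourier g p x * (character (m + p) y * (τ : Phase n → ℂ) (x, y)))
    (fun p => (integrable_integrand (m + p) τ x).const_mul _) (by
      refine Summable.of_nonneg_of_le (fun p => integral_nonneg fun y => norm_nonneg _)
        (fun p => ?_) ((summable_norm_fibreFourier g fun _ => x).mul_right B)
      have h1 := norm_setIntegral_le_of_norm_le_const (μ := volume) (s := cube n)
        (f := fun y => ‖fibreFourier g p x * (character (m + p) y * (τ : Phase n → ℂ) (x, y))‖)
        (C := ‖fibreFourier g p x‖ * B) isCompact_Icc.measure_lt_top (fun y _ => by
          rw [norm_norm, norm_mul, norm_mul, norm_character, one_mul]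
          gcongr
          exact hB _)
      rw [volume_real_cube, mul_one] at h1
      exact (le_abs_self _).trans h1)
  convert! h using 1
  · funext p
    rw [integral_const_mul]
    rfl
  · unfold weilBrezin
    congr 1
    funext y
    have h2 := (hasSum_fibreFourier g x y).mul_left (character m y * (τ : Phase n → ℂ) (x, y))
    have h3 : ∀ p, fibreFourier g p x * (character (m + p) y * (τ : Phase n → ℂ) (x, y)) =
        character m y * (τ : Phase n → ℂ) (x, y) * (fibreFourier g p x * character p y) := by
      intro p
      rw [character_add]
      ring
    simp only [h3, h2.tsum_eq, mulFunction, LinearMap.coe_mk, AddHom.coe_mk]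
    ring

/-! ### Bounds on derivatives -/

theorem multilinear_apply_eq_sum {r : ℕ}
    (A : ContinuousMultilinearMap ℝ (fun _ : Fin r => Fin n → ℝ) ℂ) (v : Fin r → Fin n → ℝ) :
    A v = ∑ i : Fin r → Fin n, (∏ l, v l (i l)) • A fun l => Pi.single (i l) 1 := by
  have h : v = fun l => ∑ j, v l j • (Pi.single j 1 : Fin n → ℝ) :=
    funext fun l => pi_eq_sum_univ' (v l)
  conv_lhs => rw [h]
  rw [A.map_sum]
  refine Finset.sum_congr rfl fun i _ => ?_
  exact A.map_smul_univ (fun l => v l (i l)) _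

theorem multilinear_norm_le {r : ℕ}
    (A : ContinuousMultilinearMap ℝ (fun _ : Fin r => Fin n → ℝ) ℂ) :
    ‖A‖ ≤ ∑ i : Fin r → Fin n, ‖A fun l => Pi.single (i l) 1‖ := by
  refine A.opNorm_le_bound (Finset.sum_nonneg fun i _ => norm_nonneg _) fun v => ?_
  rw [multilinear_apply_eq_sum, Finset.sum_mul]
  refine (norm_sum_le _ _).trans (Finset.sum_le_sum fun i _ => ?_)
  rw [norm_smul, norm_prod, mul_comm]
  gcongr with l
  exact norm_le_pi_norm (v l) (i l)

theorem testNorm_nonneg {k : ℕ+} (N : ℕ) (τ : lineSection n (-((k : ℕ) : ℤ))) :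
    0 ≤ testNorm N τ := by
  refine Real.sSup_nonneg ?_
  rintro a ⟨m, r, i, x, -, rfl⟩
  exact norm_nonneg _

/-- The point is that the supremum is finite. The derivatives are coefficients of the finitely many
sections obtained by at most `N` applications of `covX`, and each of these is globally bounded. -/
theorem norm_weilBrezin_deriv_le_testNorm {k : ℕ+} {N r : ℕ} (hr : r ≤ N)
    (τ : lineSection n (-((k : ℕ) : ℤ))) (m : Fin n → ℤ) (i : Fin r → Fin n) (x : Fin n → ℝ) :
    ‖iteratedFDeriv ℝ r (weilBrezin m τ) x fun l => Pi.single (i l) 1‖ ≤ testNorm N τ := by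
  refine le_csSup ?_ ⟨m, r, i, x, hr, rfl⟩
  choose B hB using fun q : (r : Fin (N + 1)) × (Fin r → Fin n) =>
    exists_norm_section_le (iterateOperator covX q.2 τ)
  refine ⟨∑ q, |B q|, ?_⟩
  rintro a ⟨m, r, i, x, hr, rfl⟩
  rw [iteratedFDeriv_weilBrezin]
  refine (norm_weilBrezin_le (hB ⟨⟨r, by omega⟩, i⟩) m x).trans ((le_abs_self _).trans ?_)
  exact Finset.single_le_sum (f := fun q => |B q|) (fun q _ => abs_nonneg _) (Finset.mem_univ _)

theorem norm_iteratedFDeriv_weilBrezin_le {k : ℕ+} {N r : ℕ} (hr : r ≤ N)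
    (τ : lineSection n (-((k : ℕ) : ℤ))) (m : Fin n → ℤ) (x : Fin n → ℝ) :
    ‖iteratedFDeriv ℝ r (weilBrezin m τ) x‖ ≤ (n + 1 : ℝ) ^ N * testNorm N τ := by
  refine (multilinear_norm_le _).trans ((Finset.sum_le_sum fun i _ =>
    norm_weilBrezin_deriv_le_testNorm hr τ m i x).trans ?_)
  simp only [Finset.sum_const, Finset.card_univ, Fintype.card_fun, Fintype.card_fin, nsmul_eq_mul,
    Nat.cast_pow]
  gcongr
  · exact testNorm_nonneg N τ
  -- The base `n + 1 ≥ 1` makes the bound monotone in the exponent even for `n = 0`.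
  · calc (n : ℝ) ^ r ≤ (n + 1 : ℝ) ^ r := by gcongr; linarith
      _ ≤ (n + 1 : ℝ) ^ N := by gcongr; linarith [(Nat.cast_nonneg n : (0 : ℝ) ≤ n)]

/-! ### Weights of Fourier modes and rapid decay -/

theorem one_le_prod_one_add_sq (S : Finset (Fin n)) (p : Fin n → ℤ) :
    (1 : ℝ) ≤ ∏ j ∈ S, (1 + (p j : ℝ) ^ 2) := by
  simpa using Finset.prod_le_prod (s := S) (f := fun _ => (1 : ℝ))
    (g := fun j => 1 + (p j : ℝ) ^ 2) (fun _ _ => zero_le_one)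
    fun j _ => by nlinarith [sq_nonneg (p j : ℝ)]

/-- The weight `∏ⱼ (1 + pⱼ²)` measuring the size of a Fourier mode. -/
def modeWeight (p : Fin n → ℤ) : ℝ := ∏ j, (1 + (p j : ℝ) ^ 2)

theorem one_le_modeWeight (p : Fin n → ℤ) : 1 ≤ modeWeight p :=
  one_le_prod_one_add_sq _ p

theorem modeWeight_pos (p : Fin n → ℤ) : 0 < modeWeight p :=
  zero_lt_one.trans_le (one_le_modeWeight p)

/-- Used to trade the powers of `|p|` in the Taylor remainder for powers of the weight. -/
theorem norm_intVec_le_modeWeight (p : Fin n → ℤ) : ‖intVec p‖ ≤ modeWeight p := by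
  classical
  refine (pi_norm_le_iff_of_nonneg (modeWeight_pos p).le).2 fun j => ?_
  rw [modeWeight, ← Finset.mul_prod_erase _ _ (Finset.mem_univ j)]
  have h1 : (1 : ℝ) ≤ ∏ i ∈ Finset.univ.erase j, (1 + (p i : ℝ) ^ 2) :=
    one_le_prod_one_add_sq _ p
  have h2 : ‖intVec p j‖ ≤ 1 + (p j : ℝ) ^ 2 := by
    rw [Real.norm_eq_abs, intVec, ← sq_abs]
    nlinarith [sq_nonneg (|(p j : ℝ)| - 1), abs_nonneg (p j : ℝ)]
  calc ‖intVec p j‖ ≤ (1 + (p j : ℝ) ^ 2) * 1 := by linarith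
    _ ≤ _ := by gcongr

theorem summable_modeWeight_inv : Summable fun p : Fin n → ℤ => (modeWeight p)⁻¹ := by
  simpa only [modeWeight, Finset.prod_inv_distrib] using summable_prod_inv n

theorem fibreFourier_damp_pow (f : TorusFunction n) (p : Fin n → ℤ) (x : Fin n → ℝ) (N : ℕ) :
    fibreFourier ((((List.finRange n).map dampOperator).prod ^ N) f) p x =
      ((modeWeight p : ℝ) : ℂ) ^ N * fibreFourier f p x := by
  have h2 : ((List.finRange n).map fun j => 1 + (p j : ℂ) ^ 2).prod = ((modeWeight p : ℝ) : ℂ) := by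
    rw [← List.ofFn_eq_map, List.prod_ofFn, modeWeight]
    push_cast
    rfl
  simp only [fibreFourier_eq]
  induction N with
  | zero => simp
  | succ N ih =>
    rw [pow_succ', Module.End.mul_apply, weilBrezin_damp_prod, ih, h2]
    ring

/-- Damping an `x`-derivative of `f` by the operators `1 - (2π)⁻² ∂²/∂(yʲ)²` multiplies its `p`-th
coefficient by the weight. `N` rounds give the power on the left; the general decay bound gives one
more inverse weight, which makes sums over `p` converge. -/
theorem exists_iteratedFDeriv_fibreFourier_le (f : TorusFunction n) (N : ℕ) :
    ∃ b : ℝ, 0 ≤ b ∧ ∀ r ≤ N, ∀ (p : Fin n → ℤ) (x : Fin n → ℝ),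
      modeWeight p ^ N * ‖iteratedFDeriv ℝ r (fibreFourier f p) x‖ ≤ b * (modeWeight p)⁻¹ := by
  choose B hB using fun q : (r : Fin (N + 1)) × (Fin r → Fin n) => exists_fibreFourier_le
    ((((List.finRange n).map dampOperator).prod ^ N) (iterateOperator covX q.2 f))
  refine ⟨∑ q, |B q|, Finset.sum_nonneg fun q _ => abs_nonneg _, fun r hr p x => ?_⟩
  have hw := modeWeight_pos p
  have h1 : ∀ i : Fin r → Fin n, modeWeight p ^ N *
      ‖iteratedFDeriv ℝ r (fibreFourier f p) x fun l => Pi.single (i l) 1‖ ≤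
      |B ⟨⟨r, by omega⟩, i⟩| * (modeWeight p)⁻¹ := by
    intro i
    have h2 := hB ⟨⟨r, by omega⟩, i⟩ p x
    rw [fibreFourier_damp_pow, norm_mul, norm_pow, Complex.norm_real,
      Real.norm_of_nonneg hw.le, Finset.prod_inv_distrib] at h2
    have h3 : iteratedFDeriv ℝ r (fibreFourier f p) x (fun l => Pi.single (i l) 1) =
        fibreFourier (iterateOperator covX i f) p x :=
      iteratedFDeriv_weilBrezin (-p) f x i
    rw [h3]
    refine h2.trans ?_
    change _ * (modeWeight p)⁻¹ ≤ _
    gcongr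
    exact le_abs_self _
  calc modeWeight p ^ N * ‖iteratedFDeriv ℝ r (fibreFourier f p) x‖
      ≤ modeWeight p ^ N * ∑ i : Fin r → Fin n,
          ‖iteratedFDeriv ℝ r (fibreFourier f p) x fun l => Pi.single (i l) 1‖ := by
        gcongr
        exact multilinear_norm_le _
    _ ≤ ∑ i : Fin r → Fin n, |B ⟨⟨r, by omega⟩, i⟩| * (modeWeight p)⁻¹ := by
        rw [Finset.mul_sum]
        exact Finset.sum_le_sum fun i _ => h1 i
    _ ≤ (∑ q, |B q|) * (modeWeight p)⁻¹ := by
        rw [← Finset.sum_mul]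
        gcongr
        rw [Fintype.sum_sigma]
        exact Finset.single_le_sum (f := fun r' : Fin (N + 1) =>
            ∑ i : Fin r' → Fin n, |B ⟨r', i⟩|)
          (fun r' _ => Finset.sum_nonneg fun i _ => abs_nonneg _)
          (Finset.mem_univ (⟨r, by omega⟩ : Fin (N + 1)))

/-- The product `f̂_p τ̃_{m+p}`. -/
def modeProduct (f : TorusFunction n) (m : Fin n → ℤ) (τ : lineSection n d) (p : Fin n → ℤ)
    (x : Fin n → ℝ) : ℂ :=
  fibreFourier f p x * weilBrezin (m + p) τ x

theorem contDiff_modeProduct (f : TorusFunction n) (m : Fin n → ℤ) (τ : lineSection n d)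
    (p : Fin n → ℤ) : ContDiff ℝ ∞ (modeProduct f m τ p) :=
  (contDiff_weilBrezin (-p) f).mul (contDiff_weilBrezin (m + p) τ)

/-- Leibniz rule: the decay comes from `f̂_p` alone, while `τ̃_{m+p}` is controlled by the test norm
uniformly in the mode. Hence `b` depends only on `f` and `N`. -/
theorem exists_iteratedFDeriv_modeProduct_le (f : TorusFunction n) (N : ℕ) :
    ∃ b : ℝ, 0 ≤ b ∧ ∀ (k : ℕ+) (τ : lineSection n (-((k : ℕ) : ℤ))), ∀ r ≤ N,
      ∀ (m p : Fin n → ℤ) (x : Fin n → ℝ),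
      modeWeight p ^ N * ‖iteratedFDeriv ℝ r (modeProduct f m τ p) x‖ ≤
        b * testNorm N τ * (modeWeight p)⁻¹ := by
  obtain ⟨b, hb, h⟩ := exists_iteratedFDeriv_fibreFourier_le f N
  refine ⟨2 ^ N * b * (n + 1 : ℝ) ^ N, by positivity, fun k τ r hr m p x => ?_⟩
  have hw := modeWeight_pos p
  have ht := testNorm_nonneg N τ
  have h1 := norm_iteratedFDeriv_mul_le (𝕜 := ℝ) (contDiff_weilBrezin (-p) f)
    (contDiff_weilBrezin (m + p) τ) x (n := r) (by exact_mod_cast le_top)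
  calc modeWeight p ^ N * ‖iteratedFDeriv ℝ r (modeProduct f m τ p) x‖
      ≤ modeWeight p ^ N * ∑ i ∈ Finset.range (r + 1), (r.choose i : ℝ) *
          ‖iteratedFDeriv ℝ i (fibreFourier f p) x‖ *
          ‖iteratedFDeriv ℝ (r - i) (weilBrezin (m + p) τ) x‖ := by
        gcongr
        exact h1
    _ = ∑ i ∈ Finset.range (r + 1), (r.choose i : ℝ) *
          (modeWeight p ^ N * ‖iteratedFDeriv ℝ i (fibreFourier f p) x‖) *
          ‖iteratedFDeriv ℝ (r - i) (weilBrezin (m + p) τ) x‖ := by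
        rw [Finset.mul_sum]
        exact Finset.sum_congr rfl fun i _ => by ring
    _ ≤ ∑ i ∈ Finset.range (r + 1), (r.choose i : ℝ) *
          (b * (modeWeight p)⁻¹) * ((n + 1 : ℝ) ^ N * testNorm N τ) := by
        refine Finset.sum_le_sum fun i hi => ?_
        have hi' := Finset.mem_range.1 hi
        refine mul_le_mul (mul_le_mul_of_nonneg_left (h i (by omega) p x) (Nat.cast_nonneg _))
          (norm_iteratedFDeriv_weilBrezin_le (by omega) τ (m + p) x) (norm_nonneg _) ?_
        positivity
    _ = 2 ^ r * (b * (modeWeight p)⁻¹ * ((n + 1 : ℝ) ^ N * testNorm N τ)) := by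
        have := congrArg (Nat.cast : ℕ → ℝ) (Nat.sum_range_choose r)
        push_cast at this
        rw [← this, Finset.sum_mul]
        exact Finset.sum_congr rfl fun i _ => by ring
    _ ≤ 2 ^ N * (b * (modeWeight p)⁻¹ * ((n + 1 : ℝ) ^ N * testNorm N τ)) := by
        gcongr
        exact one_le_two
    _ = _ := by ring

/-! ### The asymptotic expansion -/

theorem fibreFourier_iterate_covY (f : TorusFunction n) {r : ℕ} (j : Fin r → Fin n)
    (p : Fin n → ℤ) (x : Fin n → ℝ) :
    fibreFourier (iterateOperator covY j f) p x =
      (2 * Real.pi * Complex.I) ^ r * (∏ l, (p (j l) : ℂ)) * fibreFourier f p x := by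
  induction r with
  | zero => simp [iterateOperator]
  | succ r ih =>
    obtain ⟨e, j, rfl⟩ : ∃ e j', j = Fin.cons e j' := ⟨j 0, Fin.tail j, by simp⟩
    rw [iterateOperator_cons, Module.End.mul_apply, fibreFourier_eq, weilBrezin_covY,
      ← fibreFourier_eq, ih, Fin.prod_univ_succ]
    simp
    ring

theorem distCovX_apply (i : Fin n) (s : distSection n d) (τ : lineSection n (-d)) :
    (distCovX i s).1 τ = -(s.1 (covX i τ)) := rfl

/-- Transposition reverses the order of composition; commutativity of the `covX` restores it. -/
theorem iterate_distCovX_apply {r : ℕ} (j : Fin r → Fin n) (s : distSection n d)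
    (τ : lineSection n (-d)) :
    (iterateOperator distCovX j s).1 τ = (-1) ^ r * s.1 (iterateOperator covX j τ) := by
  induction r generalizing τ with
  | zero => simp [iterateOperator]
  | succ r ih =>
    obtain ⟨e, j, rfl⟩ : ∃ e j', j = Fin.cons e j' := ⟨j 0, Fin.tail j, by simp⟩
    have h : iterateOperator covX j (covX e τ) = covX e (iterateOperator covX j τ) :=
      (LinearMap.congr_fun (iterateOperator_comm (fun e' => covX_comm e e') j) τ).symm
    rw [iterateOperator_cons, iterateOperator_cons, Module.End.mul_apply, Module.End.mul_apply,
      distCovX_apply, ih, h]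
    ring

theorem distMul_apply (g : TorusFunction n) (s : distSection n d) (τ : lineSection n (-d)) :
    (distMul g s).1 τ = s.1 (mulFunction g τ) := rfl

theorem distSection_sum_apply {ι : Type*} (S : Finset ι) (s : ι → distSection n d)
    (τ : lineSection n (-d)) : (∑ i ∈ S, s i).1 τ = ∑ i ∈ S, (s i).1 τ := by
  simp

/-- The quantum jet has no positive powers of `ħ`, so only the term with `p = r` factors `ǔʲ`
contributes to weight `r`. -/
theorem weightToeplitz_apply (f : TorusFunction n) (r : ℕ) (k : ℕ+) (s : distSection n (k : ℕ))
    (τ : lineSection n (-((k : ℕ) : ℤ))) :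
    (weightToeplitz f r k s).1 τ =
      (Complex.I / (k : ℂ) * (2 * (Real.pi : ℂ))⁻¹) ^ r * ((r.factorial : ℂ)⁻¹ * ∑ j : Fin r → Fin n,
        (-1) ^ r * s.1 (iterateOperator covX j (mulFunction (iterateOperator covY j f) τ))) := by
  have h0 : ∀ p ∈ Finset.range (r + 1), p ≠ r →
      ((Complex.I / (k : ℂ)) ^ (r - p) * (Complex.I / (k : ℂ) * (2 * (Real.pi : ℂ))⁻¹) ^ p) •
      ∑ j : Fin p → Fin n, distMul (d := ((k : ℕ) : ℤ)) ((quantumJet f).coeff 0 p (r - p) Fin.elim0 j) ∘ₗ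
        iterateOperator distCovX j = 0 := by
    intro p hp hpr
    have h1 : r - p ≠ 0 := by
      have := Finset.mem_range.1 hp
      omega
    have h2 : distMul (n := n) (d := ((k : ℕ) : ℤ)) 0 = 0 := by
      ext s τ
      rw [distMul_apply]
      have : mulFunction (n := n) 0 τ = 0 := by
        ext z
        simp [mulFunction]
      rw [this]
      simp
    simp [quantumJet, h1, h2]
  rw [weightToeplitz, WeylSection.weightAction, Finset.sum_eq_single r h0 (by simp)]
  simp only [Nat.sub_self, pow_zero, one_mul, LinearMap.smul_apply, LinearMap.sum_apply,
    LinearMap.comp_apply, Submodule.coe_smul, smul_eq_mul, quantumJet, if_true,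
    Nat.factorial_zero, Nat.cast_one]
  congr 1
  rw [distSection_sum_apply, Finset.mul_sum]
  refine Finset.sum_congr rfl fun j _ => ?_
  rw [distMul_apply, iterate_distCovX_apply]
  have h3 : iterateOperator covX (Fin.elim0 : Fin 0 → Fin n) (iterateOperator covY j f) =
      iterateOperator covY j f := by
    simp [iterateOperator]
  have h4 : ∀ (c : ℂ) (g : TorusFunction n), mulFunction (c • g) τ = c • mulFunction g τ := by
    intro c g
    ext z
    simp [mulFunction, mul_assoc]
  rw [h3, h4, map_smul, map_smul, smul_eq_mul]
  ring

/-- The expansion of the coefficient of `f τ` can be differentiated term by term, since all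
derivatives up to order `r` are dominated by the summable inverse weight, uniformly in `x`. -/
theorem hasSum_iteratedFDeriv_mulFunction (f : TorusFunction n) {k : ℕ+} (m : Fin n → ℤ)
    (τ : lineSection n (-((k : ℕ) : ℤ))) (r : ℕ) (x : Fin n → ℝ) :
    HasSum (fun p => iteratedFDeriv ℝ r (modeProduct f m τ p) x)
      (iteratedFDeriv ℝ r (weilBrezin m (mulFunction f τ)) x) := by
  obtain ⟨b, hb, h⟩ := exists_iteratedFDeriv_modeProduct_le f r
  have h1 : ∀ i ≤ r, ∀ (p : Fin n → ℤ) (x : Fin n → ℝ),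
      ‖iteratedFDeriv ℝ i (modeProduct f m τ p) x‖ ≤ b * testNorm r τ * (modeWeight p)⁻¹ := by
    intro i hi p x
    refine le_trans ?_ (h k τ i hi m p x)
    exact le_mul_of_one_le_left (norm_nonneg _) (one_le_pow₀ (one_le_modeWeight p))
  have h2 : Summable fun p : Fin n → ℤ => b * testNorm r τ * (modeWeight p)⁻¹ :=
    summable_modeWeight_inv.mul_left _
  have h3 : weilBrezin m (mulFunction f τ) = fun x => ∑' p, modeProduct f m τ p x :=
    funext fun x => (hasSum_weilBrezin_mulFunction f m τ x).tsum_eq.symm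
  rw [h3, iteratedFDeriv_tsum_apply (N := (r : ℕ∞))
    (v := fun _ p => b * testNorm r τ * (modeWeight p)⁻¹)
    (fun p => (contDiff_modeProduct f m τ p).of_le (by exact_mod_cast le_top)) (fun _ _ => h2)
    (fun i p x hi => h1 i (by exact_mod_cast hi) p x) le_rfl]
  exact (Summable.of_norm_bounded h2 fun p => h1 r le_rfl p x).hasSum

theorem modeProduct_iterate_covY (f : TorusFunction n) {r : ℕ} (j : Fin r → Fin n)
    (m : Fin n → ℤ) (τ : lineSection n d) (p : Fin n → ℤ) :
    modeProduct (iterateOperator covY j f) m τ p =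
      ((2 * Real.pi * Complex.I) ^ r * (∏ l, (p (j l) : ℂ))) • modeProduct f m τ p := by
  funext x
  simp only [modeProduct, fibreFourier_iterate_covY, Pi.smul_apply, smul_eq_mul]
  ring

/-- The operator of weight `r` reproduces the Taylor term of order `r`. The `y`-derivatives of `f`
yield `∏ p_{j_l}`, and summing over `j` against the `x`-derivatives along the `e_{j_l}` contracts
`D^r` with `r` copies of `p`. -/
theorem hasSum_weightToeplitz_sigma (f : TorusFunction n) (r : ℕ) (k : ℕ+) (m : Fin n → ℤ)
    (τ : lineSection n (-((k : ℕ) : ℤ))) :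
    HasSum (fun p => (r.factorial : ℝ)⁻¹ • iteratedFDeriv ℝ r (modeProduct f m τ p) (modePoint k m)
        fun _ => (k : ℝ)⁻¹ • intVec p)
      ((weightToeplitz f r k (sigma k m : distSection n (k : ℕ))).1 τ) := by
  have hk : ((k : ℕ) : ℂ) ≠ 0 := by exact_mod_cast k.ne_zero
  have hpi : (Real.pi : ℂ) ≠ 0 := by exact_mod_cast Real.pi_ne_zero
  -- The three scalars come from the action of `ǔʲ`, the sign of weak derivatives and the Fourier
  -- coefficients of `y`-derivatives.
  have hc : (Complex.I / (k : ℂ) * (2 * (Real.pi : ℂ))⁻¹) ^ r * (-1) ^ r *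
      (2 * Real.pi * Complex.I) ^ r = ((k : ℂ)⁻¹) ^ r := by
    rw [← mul_pow, ← mul_pow]
    congr 1
    field_simp
    rw [Complex.I_sq]
    ring
  have h1 : ∀ j : Fin r → Fin n, HasSum
      (fun p => iteratedFDeriv ℝ r (modeProduct (iterateOperator covY j f) m τ p) (modePoint k m)
        fun l => Pi.single (j l) 1)
      ((sigma k m).1.1 (iterateOperator covX j (mulFunction (iterateOperator covY j f) τ))) := by
    intro j
    have h2 := (hasSum_iteratedFDeriv_mulFunction (iterateOperator covY j f) m τ r
      (modePoint k m)).mapL (ContinuousMultilinearMap.apply ℝ (fun _ : Fin r => Fin n → ℝ) ℂ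
        fun l => Pi.single (j l) 1)
    have h3 : (sigma k m).1.1 (iterateOperator covX j (mulFunction (iterateOperator covY j f) τ)) =
        iteratedFDeriv ℝ r (weilBrezin m (mulFunction (iterateOperator covY j f) τ)) (modePoint k m)
          fun l => Pi.single (j l) 1 := (iteratedFDeriv_weilBrezin m _ _ j).symm
    rw [h3]
    exact h2
  rw [weightToeplitz_apply]
  convert! ((hasSum_sum fun j (_ : j ∈ Finset.univ) => (h1 j).mul_left ((-1 : ℂ) ^ r)).mul_left
    (r.factorial : ℂ)⁻¹).mul_left ((Complex.I / (k : ℂ) * (2 * (Real.pi : ℂ))⁻¹) ^ r) using 1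
  funext p
  rw [multilinear_apply_eq_sum, Finset.smul_sum, Finset.mul_sum, Finset.mul_sum]
  refine Finset.sum_congr rfl fun j _ => ?_
  rw [modeProduct_iterate_covY, iteratedFDeriv_const_smul_apply
    ((contDiff_modeProduct f m τ p).contDiffAt.of_le (by exact_mod_cast le_top))]
  simp only [smul_apply, Pi.smul_apply, smul_eq_mul, intVec,
    Finset.prod_mul_distrib, Finset.prod_const, Finset.card_univ, Fintype.card_fin,
    Complex.real_smul]
  push_cast
  linear_combination (-(r.factorial : ℂ)⁻¹ * (∏ l, (p (j l) : ℂ)) *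
    iteratedFDeriv ℝ r (modeProduct f m τ p) (modePoint k m) fun l => Pi.single (j l) 1) * hc

/-- Integral form of the remainder, with `(1 - t)^N` and `1/N!` both bounded by `1`. -/
theorem norm_taylor_sub_le {E : Type*} [NormedAddCommGroup E] [NormedSpace ℝ E] {h : E → ℂ}
    (hh : ContDiff ℝ ∞ h) (N : ℕ) {B : ℝ} (hB : ∀ x, ‖iteratedFDeriv ℝ (N + 1) h x‖ ≤ B)
    (x v : E) :
    ‖h (x + v) - ∑ r ∈ Finset.range (N + 1), (r.factorial : ℝ)⁻¹ •
      iteratedFDeriv ℝ r h x fun _ => v‖ ≤ B * ‖v‖ ^ (N + 1) := by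
  have hB0 : 0 ≤ B := (norm_nonneg _).trans (hB x)
  rw [map_add_eq_sum_add_integral_iteratedFDeriv (n := N)
    (fun t _ => hh.contDiffAt.of_le (by exact_mod_cast le_top)), add_sub_cancel_left, norm_smul]
  have h1 : ‖∫ t in (0 : ℝ)..1, (1 - t) ^ N •
      iteratedFDeriv ℝ (N + 1) h (x + t • v) fun _ => v‖ ≤ B * ‖v‖ ^ (N + 1) * |1 - 0| := by
    refine intervalIntegral.norm_integral_le_of_norm_le_const fun t ht => ?_
    rw [Set.uIoc_of_le zero_le_one] at ht
    have h2 : ‖(1 - t) ^ N‖ ≤ 1 := by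
      rw [norm_pow]
      refine pow_le_one₀ (norm_nonneg _) ?_
      rw [Real.norm_eq_abs, abs_le]
      constructor <;> linarith [ht.1, ht.2]
    have h3 : ‖iteratedFDeriv ℝ (N + 1) h (x + t • v) fun _ => v‖ ≤ B * ‖v‖ ^ (N + 1) := by
      refine (ContinuousMultilinearMap.le_opNorm _ _).trans ?_
      simp only [Finset.prod_const, Finset.card_univ, Fintype.card_fin]
      gcongr
      exact hB _
    rw [norm_smul]
    calc _ ≤ 1 * (B * ‖v‖ ^ (N + 1)) := by gcongr
      _ = _ := one_mul _
  have h4 : ‖((N.factorial : ℝ))⁻¹‖ ≤ 1 := by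
    rw [norm_inv, Real.norm_natCast]
    exact inv_le_one_of_one_le₀ (by exact_mod_cast N.factorial_pos)
  calc _ ≤ 1 * (B * ‖v‖ ^ (N + 1) * |1 - 0|) := by gcongr
    _ = _ := by simp

theorem exists_norm_toeplitzSigma_sub_le (f : TorusFunction n) (N : ℕ) :
    ∃ C : ℝ, 0 < C ∧ ∀ (k : ℕ+) (m : Fin n → ℤ) (τ : lineSection n (-((k : ℕ) : ℤ))),
      ‖(toeplitzSigma f k m).1.1 τ - ∑ r ∈ Finset.range (N + 1),
          (weightToeplitz f r k (sigma k m : distSection n (k : ℕ))).1 τ‖ ≤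
        C * testNorm (N + 1) τ * (1 / (k : ℝ) ^ (N + 1)) := by
  obtain ⟨b, hb, h⟩ := exists_iteratedFDeriv_modeProduct_le f (N + 1)
  have hS : 0 ≤ ∑' p : Fin n → ℤ, (modeWeight p)⁻¹ :=
    tsum_nonneg fun p => inv_nonneg.2 (modeWeight_pos p).le
  -- The `+ 1` only secures positivity, as `b` may be zero.
  refine ⟨b * (∑' p : Fin n → ℤ, (modeWeight p)⁻¹) + 1, by positivity, fun k m τ => ?_⟩
  have hk : (0 : ℝ) < (k : ℝ) := by exact_mod_cast k.pos
  have ht := testNorm_nonneg (N + 1) τ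
  have hpoint : ∀ p, modePoint k (m + p) = modePoint k m + (k : ℝ)⁻¹ • intVec p := by
    intro p
    funext i
    simp [modePoint, intVec]
    field_simp
  have h1 : HasSum (fun p => modeProduct f m τ p (modePoint k m + (k : ℝ)⁻¹ • intVec p))
      ((toeplitzSigma f k m).1.1 τ) := by
    simp only [← hpoint]
    exact (summable_toeplitz_term f k m τ).hasSum
  have h2 := h1.sub (hasSum_sum fun r (_ : r ∈ Finset.range (N + 1)) =>
    hasSum_weightToeplitz_sigma f r k m τ)
  rw [← h2.tsum_eq]
  have h3 : ∀ p, ‖modeProduct f m τ p (modePoint k m + (k : ℝ)⁻¹ • intVec p) -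
      ∑ r ∈ Finset.range (N + 1), (r.factorial : ℝ)⁻¹ •
        iteratedFDeriv ℝ r (modeProduct f m τ p) (modePoint k m) fun _ => (k : ℝ)⁻¹ • intVec p‖ ≤
      b * testNorm (N + 1) τ * (1 / (k : ℝ) ^ (N + 1)) * (modeWeight p)⁻¹ := by
    intro p
    have hw := modeWeight_pos p
    have h4 : ∀ x, ‖iteratedFDeriv ℝ (N + 1) (modeProduct f m τ p) x‖ ≤
        b * testNorm (N + 1) τ * (modeWeight p)⁻¹ / modeWeight p ^ (N + 1) := by
      intro x
      rw [le_div_iff₀ (by positivity), mul_comm]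
      exact h k τ (N + 1) le_rfl m p x
    refine (norm_taylor_sub_le (contDiff_modeProduct f m τ p) N h4 _ _).trans ?_
    rw [norm_smul, norm_inv, Real.norm_of_nonneg hk.le, mul_pow]
    -- Bounding `|p|^{N+1}` by the same power of the weight cancels the denominator from `h4` and
    -- leaves one summable inverse weight.
    calc _ ≤ b * testNorm (N + 1) τ * (modeWeight p)⁻¹ / modeWeight p ^ (N + 1) *
          ((k : ℝ)⁻¹ ^ (N + 1) * modeWeight p ^ (N + 1)) := by
          gcongr
          exact norm_intVec_le_modeWeight p
      _ = _ := by
          rw [inv_pow, one_div]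
          generalize (k : ℝ) ^ (N + 1) = K
          field_simp
  refine (tsum_of_norm_bounded (summable_modeWeight_inv.mul_left _).hasSum h3).trans ?_
  rw [tsum_mul_left]
  have h5 : 0 ≤ testNorm (N + 1) τ * (1 / (k : ℝ) ^ (N + 1)) := by positivity
  linarith

end SymplecticTorus

end

/-! ### Extension from the basis sections by linearity -/

open SymplecticTorus
theorem mainTheorem4 (n : ℕ) (f : TorusFunction n) (N : ℕ) :
    ∃ C : ℝ, 0 < C ∧ ∀ (k : ℕ+) (s : polarizedSection n (k : ℕ))
      (τ : lineSection n (-((k : ℕ) : ℤ))),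
      ‖((toeplitz f k s : distSection n (k : ℕ)) -
          ∑ r ∈ Finset.range (N + 1), weightToeplitz f r k (s : distSection n (k : ℕ))).1 τ‖ ≤
        C * l1Norm s * testNorm (N + 1) τ * (1 / (k : ℝ) ^ (N + 1)) := by
  obtain ⟨C, hC, h⟩ := exists_norm_toeplitzSigma_sub_le f N
  refine ⟨C, hC, fun k s τ => ?_⟩
  -- `coefficients` is defined as a left inverse of `combination`, so it has its intended meaning
  -- for every `s` only because `combination` is surjective.
  obtain ⟨c, rfl⟩ := exists_eq_combination k s
  have h1 : (toeplitz f k (combination n k c)).1.1 τ =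
      ∑ m, c m * (toeplitzSigma f k fun i => ((m i : ℕ) : ℤ)).1.1 τ := by
    simp [toeplitz, coefficients_combination, Fintype.linearCombination_apply]
  have h2 : ∀ r, (weightToeplitz f r k (combination n k c : distSection n (k : ℕ))).1 τ =
      ∑ m, c m * (weightToeplitz f r k
        (sigma k fun i => ((m i : ℕ) : ℤ) : distSection n (k : ℕ))).1 τ := by
    intro r
    simp [combination, Fintype.linearCombination_apply]
  have h3 : ((toeplitz f k (combination n k c) : distSection n (k : ℕ)) -
      ∑ r ∈ Finset.range (N + 1),
        weightToeplitz f r k (combination n k c : distSection n (k : ℕ))).1 τ =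
      ∑ m, c m * ((toeplitzSigma f k fun i => ((m i : ℕ) : ℤ)).1.1 τ -
        ∑ r ∈ Finset.range (N + 1), (weightToeplitz f r k
          (sigma k fun i => ((m i : ℕ) : ℤ) : distSection n (k : ℕ))).1 τ) := by
    rw [Submodule.coe_sub, LinearMap.sub_apply, distSection_sum_apply, h1]
    simp only [h2, mul_sub, Finset.sum_sub_distrib, Finset.mul_sum]
    congr 1
    exact Finset.sum_comm
  rw [h3, l1Norm, coefficients_combination]
  calc _ ≤ ∑ m, ‖c m‖ * (C * testNorm (N + 1) τ * (1 / (k : ℝ) ^ (N + 1))) := by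
        refine (norm_sum_le _ _).trans (Finset.sum_le_sum fun m _ => ?_)
        rw [norm_mul]
        exact mul_le_mul_of_nonneg_left (h k _ τ) (norm_nonneg _)
    _ = _ := by
        rw [← Finset.sum_mul]
        ring
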